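/- Let $\mathfrak L>0$ and let $\rho:\mathbb R\to[0,\infty)$ be an $\mathfrak L$-regular probability density, meaning: (i) $\rho(x)\le \mathfrak L(1+x^2)^{-1}$ for all $x$; (ii) $\rho(x)\ge \mathfrak L^{-1}$ for $|x|\le \mathfrak L^{-1}$; (iii) $\rho$ is differentiable everywhere with $|\rho'(x)|\le \mathfrak L(1+|x|)^{-1-1/\mathfrak L}$; (iv) $\inf_{|x|<v}\rho(x)>0$ for every $v>0$; (v) $\rho'$ has finitely many zeros. Let $s\in(0,1)$, $t>0$, $E\in\mathbb R$, and let $K>1$ be an integer. Let $\Gamma$ be any real-valued random variable solving the recursive distributional equation $$\Gamma\overset{d}{=}\frac{1}{V_0-E-t^2\sum_{i=1}^K\Gamma_i},$$ where $V_0$ has density $\rho$, the $\Gamma_i$ are copies of $\Gamma$, and $V_0,\Gamma_1,\dots,\Gamma_K$ are independent. Let $\rho_E$ denote the density of $V_0-E-t^2\sum_{i=1}^{K-1}\Gamma_i$, and set, for $x\neq0$, $$(Fu)(x)=\frac{t^{2-s}}{|x|^{2-s}}\int_{-\infty}^{\infty}\rho_E\Big(-y-\frac{t^2}{x}\Big)u(y)\,dy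 .$$ Let $\mathcal X$ be the weighted $L^\infty$ space of (almost everywhere classes of) measurable functions $f:\mathbb R\to\mathbb R$ with $\|f\|:=\|f\,w\|_{\infty}<\infty$, where $w(x)=1+|x|^{2-s}$. Then the integral defining $(Fu)(x)$ converges absolutely for all $u\in\mathcal X$ and $x\ne0$, and $F$ is a bounded linear operator $\mathcal X\to\mathcal X$. There exist $\lambda>0$ and an eigenvector $v\in\mathcal X$ with $Fv=\lambda v$, such that $v$ has a continuous representative with $v(x)>0$ for all $x\in\mathbb R$. Moreover $\lambda$ is the spectral radius of $F$: it is the supremum of $|k|$ over the real spectrum of $F$, and $\lambda=\lim_{n\to\infty}\|F^n\|^{1/n}$. Finally, $F$ has no other non-negative eigenvectors: if $u\in\mathcal X\setminus\{0\}$ satisfies $u\ge0$ almost everywhere and $Fu=\kappa u$ for some $\kappa\in\mathbb R$, then $\kappa=\lambda$ and $u=cv$ for some $c>0$. -/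

import Mathlib

open MeasureTheory Filter Topology
open scoped ENNReal

/-- `p` is an `L`-regular probability density on `ℝ`. -/
structure IsRegularDensity (L : ℝ) (p : ℝ → ℝ) : Prop where
  nonneg : ∀ x, 0 ≤ p x
  integral_eq_one : ∫ x, p x = 1
  upper : ∀ x, p x ≤ L * (1 + x ^ 2)⁻¹
  lower : ∀ x ∈ Set.Icc (-L⁻¹) L⁻¹, L⁻¹ ≤ p x
  differentiable : Differentiable ℝ p
  deriv_bound : ∀ x, |deriv p x| ≤ L * (1 + |x|) ^ (-1 - 1 / L)
  locally_pos : ∀ v : ℝ, 0 < v → ∃ c : ℝ, 0 < c ∧ ∀ x, |x| < v → c ≤ p x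
  finite_critical : {x | deriv p x = 0}.Finite

/-- The law of `V₀ - E - t² ∑_{i=1}^M Γ_i`, where `V₀` has density `ρ`, the `Γ_i` have law `μ`,
and `V₀, Γ_1, …, Γ_M` are independent. -/
noncomputable def denominatorLaw (ρ : ℝ → ℝ) (t E : ℝ) (M : ℕ) (μ : Measure ℝ) : Measure ℝ :=
  Measure.map (fun q : ℝ × (Fin M → ℝ) => q.1 - E - t ^ 2 * ∑ i, q.2 i)
    ((volume.withDensity fun x => ENNReal.ofReal (ρ x)).prod (Measure.pi fun _ : Fin M => μ))

/-- `μ` is the law of a real random variable `Γ` that solves the recursive distributional equation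
`Γ = 1 / (V₀ - E - t² ∑_{i=1}^K Γ_i)` in law. (The denominator vanishes with probability zero,
as `V₀` has a density.) -/
def SolvesRDE (ρ : ℝ → ℝ) (K : ℕ) (t E : ℝ) (μ : Measure ℝ) : Prop :=
  μ = Measure.map (fun x : ℝ => x⁻¹) (denominatorLaw ρ t E K μ)

/-- The density `ρ_E` of `V₀ - E - t² ∑_{i=1}^{K-1} Γ_i`. -/
noncomputable def selfEnergyDensity (ρ : ℝ → ℝ) (K : ℕ) (t E : ℝ) (μ : Measure ℝ) (x : ℝ) : ℝ :=
  ((denominatorLaw ρ t E (K - 1) μ).rnDeriv volume x).toReal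

/-- The value at `x ≠ 0` of the transfer operator applied to the function `u`. -/
noncomputable def transfer (ρ : ℝ → ℝ) (K : ℕ) (t s E : ℝ) (μ : Measure ℝ) (u : ℝ → ℝ)
    (x : ℝ) : ℝ :=
  t ^ (2 - s) / |x| ^ (2 - s) * ∫ y, selfEnergyDensity ρ K t E μ (-y - t ^ 2 / x) * u y

/-- The weight `w(x) = 1 + |x|^(2-s)`. -/
noncomputable def weight (s x : ℝ) : ℝ := 1 + |x| ^ (2 - s)

theorem weight_pos (s x : ℝ) : 0 < weight s x := by
  unfold weight; positivity

theorem measurable_weight (s : ℝ) : Measurable (weight s) := by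
  unfold weight; fun_prop

/-- Almost everywhere classes of functions `f` for which `f w` is essentially bounded. -/
noncomputable def weightedSubmodule (s : ℝ) : Submodule ℝ (ℝ →ₘ[volume] ℝ) where
  carrier := {f | MemLp (fun x => f x * weight s x) ∞ volume}
  add_mem' := by
    intro f g hf hg
    refine (memLp_congr_ae ?_).2 (hf.add hg)
    filter_upwards [AEEqFun.coeFn_add f g] with x hx
    simp [hx, add_mul]
  zero_mem' := by
    refine (memLp_congr_ae ?_).2 (MemLp.zero (ε := ℝ))
    filter_upwards [AEEqFun.coeFn_zero (α := ℝ) (β := ℝ) (μ := volume)] with x hx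
    simp [hx]
  smul_mem' := by
    intro c f hf
    refine (memLp_congr_ae ?_).2 (hf.const_smul c)
    filter_upwards [AEEqFun.coeFn_smul c f] with x hx
    simp [hx, mul_assoc]

/-- The weighted `L^∞` space `𝒳`, of almost everywhere classes of functions `f : ℝ → ℝ` with
`‖f w‖_∞ < ∞`. -/
def WeightedLInfty (s : ℝ) : Type := ↥(weightedSubmodule s)

namespace WeightedLInfty

noncomputable instance (s : ℝ) : AddCommGroup (WeightedLInfty s) :=
  inferInstanceAs (AddCommGroup ↥(weightedSubmodule s))

noncomputable instance (s : ℝ) : Module ℝ (WeightedLInfty s) :=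
  inferInstanceAs (Module ℝ ↥(weightedSubmodule s))

noncomputable instance (s : ℝ) : CoeFun (WeightedLInfty s) fun _ => ℝ → ℝ :=
  ⟨fun f => (f.1 : ℝ →ₘ[volume] ℝ)⟩

/-- Multiplication by the weight, `f ↦ f w`, as a linear map from `𝒳` to `L^∞`. -/
noncomputable def mulWeight (s : ℝ) : WeightedLInfty s →ₗ[ℝ] Lp ℝ ∞ (volume : Measure ℝ) where
  toFun f := MemLp.toLp (fun x => f x * weight s x) f.2
  map_add' f g := by
    rw [← MemLp.toLp_add f.2 g.2]
    refine MemLp.toLp_congr _ _ ?_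
    filter_upwards [AEEqFun.coeFn_add f.1 g.1] with x hx
    have h : (f + g) x = f x + g x := hx
    simp [h, add_mul]
  map_smul' c f := by
    rw [RingHom.id_apply, ← MemLp.toLp_const_smul c f.2]
    refine MemLp.toLp_congr _ _ ?_
    filter_upwards [AEEqFun.coeFn_smul c f.1] with x hx
    have h : (c • f) x = c * f x := hx
    simp [h, mul_assoc]

theorem mulWeight_injective (s : ℝ) : Function.Injective (mulWeight s) := by
  intro f g h
  have h' := (MemLp.toLp_eq_toLp_iff f.2 g.2).1 h
  refine Subtype.ext (AEEqFun.ext ?_)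
  filter_upwards [h'] with x hx
  exact mul_right_cancel₀ (weight_pos s x).ne' hx

/-- The norm `‖f‖ = ‖f w‖_∞`. -/
noncomputable instance (s : ℝ) : NormedAddCommGroup (WeightedLInfty s) :=
  NormedAddCommGroup.induced (WeightedLInfty s) (Lp ℝ ∞ (volume : Measure ℝ)) (mulWeight s)
    (mulWeight_injective s)

noncomputable instance (s : ℝ) : NormedSpace ℝ (WeightedLInfty s) :=
  NormedSpace.induced ℝ (WeightedLInfty s) (Lp ℝ ∞ (volume : Measure ℝ)) (mulWeight s)

theorem norm_eq (s : ℝ) (f : WeightedLInfty s) :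
    ‖f‖ = (eLpNorm (fun x => f x * weight s x) ∞ volume).toReal :=
  Lp.norm_toLp _ f.2

end WeightedLInfty

/-! The argument is a Perron–Frobenius theorem obtained from two-sided kernel bounds, with no
compactness. Write `w` for the weight and ρ_E for the density in the kernel.

Kernel bounds. The fixed-point equation gives Γ a density at z equal to z⁻² times a bounded,
continuous, strictly positive function of 1/z. So Γ has Cauchy tails, and since K > 1 at least one
copy of Γ enters ρ_E; hence ρ_E lies between multiples of (1 + x²)⁻¹ (`exists_iterDensity_le`,
`exists_le_iterDensity_succ`). The map x ↦ t²/x exchanges 0 and infinity and matches the prefactor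
|x|^(s-2) with the weight. It follows that F³ is comparable on nonnegative functions to a rank one
operator: F³u lies between multiples of ℓ(u)·w⁻¹, where ℓ(u) = ∫ (1 + |y|)^(-s) u(y) dy
(`exists_transfer_cube_le`, `exists_le_transfer_cube`).

Abstract part. The norm of the weighted space is the order unit norm of w⁻¹. An operator T
comparable to a rank one operator contracts the oscillation of ratios of positive vectors
(`exists_contraction`, in the spirit of Birkhoff and Hopf). Normalized iterates of T are then
Cauchy, and nonnegative eigenvectors are unique up to scaling. With T = F³, uniqueness and
commutation turn the eigenvector of F³ into one of F. Since it is comparable to w⁻¹, it bounds the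
powers of F from both sides by λⁿ, which gives Gelfand's limit (`perron_frobenius`).

Continuity. Away from 0 an eigenfunction is a continuous factor times a convolution evaluated at
t²/x. Near 0 the question is the decay of that convolution at infinity: the eigenfunction behaves
like a constant times |z|^(s-2) there, and the tails of ρ_E are lighter, so the rescaled convolution
has a limit (`exists_continuous_eigenvector`). -/

set_option linter.unusedSectionVars false

/-! ### Perron–Frobenius theory in order unit spaces. -/

section OrderUnit

variable {E : Type*} [NormedAddCommGroup E] [NormedSpace ℝ E] [PartialOrder E]

/-- The norm of the ordered space `E` is the gauge of the order interval `[-e, e]`. -/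
def IsOrderUnitNorm (e : E) : Prop :=
  ∀ (u : E) (C : ℝ), 0 ≤ C → (‖u‖ ≤ C ↔ -(C • e) ≤ u ∧ u ≤ C • e)

/-- The operator `T` is comparable, on the positive cone, to the rank one operator `ℓ ⊗ e`. -/
structure IsRankOneComparable (e : E) (T : E →L[ℝ] E) (ℓ : E →ₗ[ℝ] ℝ) (c C : ℝ) : Prop where
  lower_pos : 0 < c
  upper_pos : 0 < C
  functional_pos : ∀ u, 0 ≤ u → u ≠ 0 → 0 < ℓ u
  lower : ∀ u, 0 ≤ u → (c * ℓ u) • e ≤ T u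
  upper : ∀ u, 0 ≤ u → T u ≤ (C * ℓ u) • e

variable [IsOrderedAddMonoid E] [IsOrderedModule ℝ E] {e : E}

namespace IsOrderUnitNorm

variable (h : IsOrderUnitNorm e)
include h

theorem unit_nonneg : 0 ≤ e := by
  have := ((h 0 1 zero_le_one).1 (by simp)).2
  simpa using this

theorem le_norm_smul (u : E) : u ≤ ‖u‖ • e := ((h u _ (norm_nonneg u)).1 le_rfl).2

theorem norm_le_of_nonneg {u : E} {C : ℝ} (hC : 0 ≤ C) (hu : 0 ≤ u) (hu' : u ≤ C • e) :
    ‖u‖ ≤ C :=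
  (h u C hC).2 ⟨(neg_nonpos.2 (smul_nonneg hC h.unit_nonneg)).trans hu, hu'⟩

/-- The order can be read off from the norm: `u` is nonnegative exactly when `‖u‖ • e - u` has norm
at most `‖u‖`, and this is a closed condition. -/
theorem isClosed_nonneg : IsClosed {u : E | 0 ≤ u} := by
  have : {u : E | 0 ≤ u} = {u : E | ‖‖u‖ • e - u‖ ≤ ‖u‖} := by
    ext u
    simp only [Set.mem_ofPred_eq]
    refine ⟨fun hu => h.norm_le_of_nonneg (norm_nonneg u) ?_ ?_, fun hu => ?_⟩
    · exact sub_nonneg.2 (h.le_norm_smul u)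
    · exact sub_le_self _ hu
    · have := ((h _ _ (norm_nonneg u)).1 hu).2
      exact (sub_le_self_iff _).1 this
  rw [this]
  exact isClosed_le (by fun_prop) (by fun_prop)

theorem le_of_tendsto {f g : ℕ → E} {u v : E} (hf : Tendsto f atTop (𝓝 u))
    (hg : Tendsto g atTop (𝓝 v)) (hfg : ∀ n, f n ≤ g n) : u ≤ v :=
  sub_nonneg.1 <| h.isClosed_nonneg.mem_of_tendsto (hg.sub hf)
    (Eventually.of_forall fun n => sub_nonneg.2 (hfg n))

end IsOrderUnitNorm

namespace IsRankOneComparable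

variable {T : E →L[ℝ] E} {ℓ : E →ₗ[ℝ] ℝ} {c C : ℝ} (hT : IsRankOneComparable e T ℓ c C)
include hT

theorem functional_nonneg {u : E} (hu : 0 ≤ u) : 0 ≤ ℓ u := by
  rcases eq_or_ne u 0 with rfl | h
  · simp
  · exact (hT.functional_pos u hu h).le

theorem functional_mono {u v : E} (huv : u ≤ v) : ℓ u ≤ ℓ v := by
  have := hT.functional_nonneg (sub_nonneg.2 huv)
  rw [map_sub] at this
  linarith

theorem map_nonneg (he : 0 ≤ e) {u : E} (hu : 0 ≤ u) : 0 ≤ T u :=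
  (smul_nonneg (mul_nonneg hT.lower_pos.le (hT.functional_nonneg hu)) he).trans (hT.lower u hu)

theorem continuous_functional (h : IsOrderUnitNorm e) : Continuous ℓ := by
  refine AddMonoidHomClass.continuous_of_bound ℓ (ℓ e) fun u => ?_
  obtain ⟨h1, h2⟩ := (h u _ (norm_nonneg u)).1 le_rfl
  have h3 := hT.functional_mono h1
  have h4 := hT.functional_mono h2
  rw [map_neg, map_smul, smul_eq_mul] at h3
  rw [map_smul, smul_eq_mul] at h4
  rw [Real.norm_eq_abs, abs_le]
  constructor <;> linarith

/-- Both images are compared with `e`. In the contraction estimate `w` is one of the two gaps `u - m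
• v` and `M • v - u`. -/
theorem smul_le_map {v w : E} (hv : 0 ≤ v) (hℓ : 0 < ℓ v) (hw : 0 ≤ w) :
    (c / C * (ℓ w / ℓ v)) • T v ≤ T w := by
  have hc := hT.lower_pos
  have hC := hT.upper_pos
  have hℓw := hT.functional_nonneg hw
  calc (c / C * (ℓ w / ℓ v)) • T v ≤ (c / C * (ℓ w / ℓ v)) • (C * ℓ v) • e :=
        smul_le_smul_of_nonneg_left (hT.upper v hv) (by positivity)
    _ = (c * ℓ w) • e := by rw [smul_smul]; congr 1; field_simp
    _ ≤ T w := hT.lower w hw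

/-- The operator contracts the oscillation of the ratio of two vectors. -/
theorem exists_contraction {u v : E} {m M : ℝ} (hv : 0 ≤ v) (hℓ : 0 < ℓ v) (h1 : m • v ≤ u)
    (h2 : u ≤ M • v) : ∃ m' M' : ℝ, m ≤ m' ∧ M' ≤ M ∧ M' - m' ≤ (1 - c / C) * (M - m) ∧
      m' • T v ≤ T u ∧ T u ≤ M' • T v := by
  have hc := hT.lower_pos
  have hC := hT.upper_pos
  have k1 := hT.smul_le_map hv hℓ (sub_nonneg.2 h1)
  have k2 := hT.smul_le_map hv hℓ (sub_nonneg.2 h2)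
  have p1 := hT.functional_nonneg (sub_nonneg.2 h1)
  have p2 := hT.functional_nonneg (sub_nonneg.2 h2)
  refine ⟨m + c / C * (ℓ (u - m • v) / ℓ v), M - c / C * (ℓ (M • v - u) / ℓ v), ?_, ?_, ?_, ?_, ?_⟩
  · have : 0 ≤ c / C * (ℓ (u - m • v) / ℓ v) := by positivity
    linarith
  · have : 0 ≤ c / C * (ℓ (M • v - u) / ℓ v) := by positivity
    linarith
  -- The two corrections add up to `c / C * (M - m)`, because the two gaps sum to `(M - m) • v`.
  · refine le_of_eq ?_
    simp only [map_sub, map_smul, smul_eq_mul]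
    field_simp
    ring
  · rw [add_smul]
    simp only [map_sub, map_smul] at k1 ⊢
    rw [le_sub_iff_add_le'] at k1
    exact k1
  · rw [sub_smul]
    simp only [map_sub, map_smul] at k2 ⊢
    exact le_sub_comm.1 k2

theorem lower_le_upper (he : 0 < e) : c ≤ C := by
  by_contra! hlt
  have h1 := (hT.lower e he.le).trans (hT.upper e he.le)
  have h2 := hT.functional_mono h1
  have hpos := hT.functional_pos e he.le he.ne'
  simp only [map_smul, smul_eq_mul] at h2
  nlinarith [mul_pos hpos hpos]

/-- Existence of a positive eigenvector of `T`. -/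
theorem exists_eigenvector [CompleteSpace E] (h : IsOrderUnitNorm e) (he : e ≠ 0) :
    ∃ (κ : ℝ) (v : E), 0 < κ ∧ 0 ≤ v ∧ v ≠ 0 ∧ T v = κ • v := by
  have hc := hT.lower_pos
  have hC := hT.upper_pos
  have he0 := h.unit_nonneg
  have hcC : c ≤ C := hT.lower_le_upper (lt_of_le_of_ne he0 he.symm)
  have hℓe := hT.functional_pos e he0 he
  set θ : ℝ := 1 - c / C with hθ
  have hθ0 : 0 ≤ θ := sub_nonneg.2 ((div_le_one hC).2 hcC)
  have hθ1 : θ < 1 := sub_lt_self _ (by positivity)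
  -- Power iteration, normalized by `ℓ = 1` and started at a multiple of `e`.
  let φ : E → E := fun v => (ℓ (T v))⁻¹ • T v
  let x : ℕ → E := fun n => φ^[n] ((ℓ e)⁻¹ • e)
  have hx_succ (n : ℕ) : x (n + 1) = (ℓ (T (x n)))⁻¹ • T (x n) :=
    Function.iterate_succ_apply' φ n _
  set B : ℝ := max (ℓ e)⁻¹ (C / (c * ℓ e)) with hB
  have hB0 : 0 < B := lt_of_lt_of_le (by positivity) (le_max_left _ _)
  -- This keeps the normalizing factors away from zero.
  have key (v : E) (hv : 0 ≤ v) (hℓ : ℓ v = 1) : c * ℓ e ≤ ℓ (T v) := by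
    have := hT.functional_mono (hT.lower v hv)
    rw [map_smul, hℓ, smul_eq_mul] at this
    linarith
  have hx (n : ℕ) : 0 ≤ x n ∧ ℓ (x n) = 1 ∧ x n ≤ B • e := by
    induction n with
    | zero =>
      refine ⟨smul_nonneg (by positivity) he0, ?_, ?_⟩
      · change ℓ ((ℓ e)⁻¹ • e) = 1
        rw [map_smul, smul_eq_mul, inv_mul_cancel₀ hℓe.ne']
      · exact smul_le_smul_of_nonneg_right (le_max_left _ _) he0
    | succ n ih =>
      have hk := key _ ih.1 ih.2.1
      have hk0 : 0 < ℓ (T (x n)) := lt_of_lt_of_le (by positivity) hk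
      rw [hx_succ]
      refine ⟨smul_nonneg (by positivity) (hT.map_nonneg he0 ih.1), ?_, ?_⟩
      · rw [map_smul, smul_eq_mul, inv_mul_cancel₀ hk0.ne']
      · have := hT.upper _ ih.1
        rw [ih.2.1, mul_one] at this
        calc (ℓ (T (x n)))⁻¹ • T (x n) ≤ (ℓ (T (x n)))⁻¹ • C • e :=
              smul_le_smul_of_nonneg_left this (by positivity)
          _ ≤ (c * ℓ e)⁻¹ • C • e :=
              smul_le_smul_of_nonneg_right (inv_anti₀ (by positivity) hk) (smul_nonneg hC.le he0)
          _ = (C / (c * ℓ e)) • e := by rw [smul_smul]; congr 1; field_simp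
          _ ≤ B • e := smul_le_smul_of_nonneg_right (le_max_right _ _) he0
  -- `T (x n)` is trapped between multiples of `x n` whose gap shrinks geometrically; each
  -- application of `T` contributes a factor `θ`.
  have hosc : ∃ D : ℝ, 0 ≤ D ∧ ∀ n, ∃ m M : ℝ, M - m ≤ D * θ ^ n ∧
      m • x n ≤ T (x n) ∧ T (x n) ≤ M • x n := by
    refine ⟨C * ℓ e, by positivity, fun n => ?_⟩
    induction n with
    | zero =>
      refine ⟨0, C * ℓ e, by simp, ?_, ?_⟩
      · rw [zero_smul]; exact hT.map_nonneg he0 (hx 0).1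
      · have := hT.upper _ (hx 0).1
        rw [(hx 0).2.1] at this
        refine this.trans (le_of_eq ?_)
        change (C * 1) • e = (C * ℓ e) • (ℓ e)⁻¹ • e
        rw [smul_smul]; congr 1; field_simp
    | succ n ih =>
      obtain ⟨m, M, h0, h1, h2⟩ := ih
      obtain ⟨m', M', -, -, k3, k4, k5⟩ :=
        hT.exists_contraction (hx n).1 (by rw [(hx n).2.1]; exact one_pos) h1 h2
      refine ⟨m', M', ?_, ?_, ?_⟩
      · calc M' - m' ≤ θ * (M - m) := k3
          _ ≤ θ * (C * ℓ e * θ ^ n) := mul_le_mul_of_nonneg_left h0 hθ0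
          _ = _ := by ring
      all_goals
        have hk0 : 0 < ℓ (T (x n)) := lt_of_lt_of_le (by positivity) (key _ (hx n).1 (hx n).2.1)
        rw [hx_succ, map_smul, smul_comm]
        exact smul_le_smul_of_nonneg_left (by assumption) (by positivity)
  obtain ⟨D, hD0, hD⟩ := hosc
  -- Applying `ℓ` to the two bounds puts `ℓ (T (x n))` in `[m, M]`, so the residual lies within `(M
  -- - m) • x n`.
  have hres (n : ℕ) : ‖T (x n) - ℓ (T (x n)) • x n‖ ≤ D * B * θ ^ n := by
    obtain ⟨m, M, h0, h1, h2⟩ := hD n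
    have hm := hT.functional_mono h1
    have hM := hT.functional_mono h2
    rw [map_smul, (hx n).2.1, smul_eq_mul, mul_one] at hm hM
    have hmM : 0 ≤ M - m := by linarith
    have hb : (M - m) • x n ≤ (D * B * θ ^ n) • e := by
      calc (M - m) • x n ≤ (M - m) • B • e := smul_le_smul_of_nonneg_left (hx n).2.2 hmM
        _ ≤ (D * θ ^ n) • B • e := smul_le_smul_of_nonneg_right h0 (smul_nonneg hB0.le he0)
        _ = _ := by rw [smul_smul]; congr 1; ring
    refine (h _ _ (by positivity)).2 ⟨?_, ?_⟩
    · refine (neg_le_neg hb).trans ?_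
      rw [← neg_smul, neg_sub, sub_smul]
      exact sub_le_sub h1 (smul_le_smul_of_nonneg_right hM (hx n).1)
    · refine le_trans ?_ hb
      rw [sub_smul]
      exact sub_le_sub h2 (smul_le_smul_of_nonneg_right hm (hx n).1)
  have hcauchy : CauchySeq x := by
    refine cauchySeq_of_le_geometric θ (D * B / (c * ℓ e)) hθ1 fun n => ?_
    have hk := key _ (hx n).1 (hx n).2.1
    have hk0 : 0 < ℓ (T (x n)) := lt_of_lt_of_le (by positivity) hk
    have : x (n + 1) - x n = (ℓ (T (x n)))⁻¹ • (T (x n) - ℓ (T (x n)) • x n) := by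
      rw [smul_sub, smul_smul, inv_mul_cancel₀ hk0.ne', one_smul, hx_succ]
    rw [dist_comm, dist_eq_norm, this, norm_smul, norm_inv, Real.norm_of_nonneg hk0.le]
    calc (ℓ (T (x n)))⁻¹ * ‖T (x n) - ℓ (T (x n)) • x n‖
        ≤ (c * ℓ e)⁻¹ * (D * B * θ ^ n) := by
          have := hres n
          gcongr
      _ = _ := by ring
  obtain ⟨v, hv⟩ := cauchySeq_tendsto_of_complete hcauchy
  have hcont := hT.continuous_functional h
  have hℓv : ℓ v = 1 :=
    tendsto_nhds_unique ((hcont.tendsto v).comp hv) (by simp [Function.comp_def, (hx _).2.1])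
  have hv0 : 0 ≤ v := h.le_of_tendsto tendsto_const_nhds hv fun n => (hx n).1
  refine ⟨ℓ (T v), v, lt_of_lt_of_le (by positivity) (key v hv0 hℓv), hv0, ?_, ?_⟩
  · rintro rfl
    simp at hℓv
  · have h1 : Tendsto (fun n => T (x n) - ℓ (T (x n)) • x n) atTop (𝓝 (T v - ℓ (T v) • v)) := by
      have : Continuous fun y => T y - ℓ (T y) • y := by fun_prop
      exact (this.tendsto v).comp hv
    have h2 : Tendsto (fun n => T (x n) - ℓ (T (x n)) • x n) atTop (𝓝 0) := by
      refine squeeze_zero_norm hres ?_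
      simpa using (tendsto_pow_atTop_nhds_zero_of_lt_one hθ0 hθ1).const_mul (D * B)
    exact sub_eq_zero.1 (tendsto_nhds_unique h1 h2)

/-- A nonnegative eigenvector of `T` is comparable to the order unit. -/
theorem eigenvector_comparable (h : IsOrderUnitNorm e) (he : e ≠ 0) {κ : ℝ} {v : E} (hv : 0 ≤ v)
    (hv0 : v ≠ 0) (hTv : T v = κ • v) : 0 < κ ∧ ∃ ε : ℝ, 0 < ε ∧ ε • e ≤ v := by
  have he0 := h.unit_nonneg
  have hℓe := hT.functional_pos e he0 he
  have hℓv := hT.functional_pos v hv hv0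
  have hc := hT.lower_pos
  have h1 := hT.lower v hv
  rw [hTv] at h1
  have hκ : 0 < κ := by
    have := hT.functional_mono h1
    simp only [map_smul, smul_eq_mul] at this
    exact pos_of_mul_pos_left (lt_of_lt_of_le (by positivity) this) hℓv.le
  refine ⟨hκ, κ⁻¹ * (c * ℓ v), by positivity, ?_⟩
  have := smul_le_smul_of_nonneg_left h1 (inv_pos.2 hκ).le
  rwa [smul_smul, smul_smul, inv_mul_cancel₀ hκ.ne', one_smul] at this

/-- Since `u` dominates a multiple of `e`, it dominates a multiple of `v`. Iterating `T` preserves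
this, so `κ ^ n` is bounded by a constant times `κ' ^ n`. -/
theorem eigenvalue_le (h : IsOrderUnitNorm e) (he : e ≠ 0) {κ κ' : ℝ} {u v : E} (hv : 0 ≤ v)
    (hv0 : v ≠ 0) (hTv : T v = κ • v) (hu : 0 ≤ u) (hu0 : u ≠ 0) (hTu : T u = κ' • u) :
    κ ≤ κ' := by
  obtain ⟨hκ', ε, hε, hεu⟩ := hT.eigenvector_comparable h he hu hu0 hTu
  obtain ⟨hκ, -⟩ := hT.eigenvector_comparable h he hv hv0 hTv
  have he0 := h.unit_nonneg
  have hℓu := hT.functional_pos u hu hu0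
  have hℓv := hT.functional_pos v hv hv0
  have h0 : v ≤ (‖v‖ / ε) • u := by
    calc v ≤ ‖v‖ • e := h.le_norm_smul v
      _ = (‖v‖ / ε) • ε • e := by rw [smul_smul]; congr 1; field_simp
      _ ≤ _ := smul_le_smul_of_nonneg_left hεu (by positivity)
  have hn (n : ℕ) : κ ^ n • v ≤ (‖v‖ / ε * κ' ^ n) • u := by
    induction n with
    | zero => simpa using h0
    | succ n ih =>
      have := hT.map_nonneg he0 (sub_nonneg.2 ih)
      rw [map_sub, map_smul, map_smul, hTu, hTv, sub_nonneg, smul_smul, smul_smul] at this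
      convert this using 2 <;> ring
  by_contra! hlt
  have hn' (n : ℕ) : (κ / κ') ^ n ≤ ‖v‖ / ε * ℓ u / ℓ v := by
    have := hT.functional_mono (hn n)
    simp only [map_smul, smul_eq_mul] at this
    rw [div_pow, div_le_div_iff₀ (by positivity) hℓv]
    linarith
  obtain ⟨n, hn1⟩ := pow_unbounded_of_one_lt (‖v‖ / ε * ℓ u / ℓ v) ((one_lt_div hκ').2 hlt)
  exact absurd (hn' n) hn1.not_ge

/-- Nonnegative eigenvectors of `T` are unique. -/
theorem eigenvector_unique (h : IsOrderUnitNorm e) (he : e ≠ 0) {κ κ' : ℝ} {u v : E} (hv : 0 ≤ v)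
    (hv0 : v ≠ 0) (hTv : T v = κ • v) (hu : 0 ≤ u) (hu0 : u ≠ 0) (hTu : T u = κ' • u) :
    κ' = κ ∧ ∃ c : ℝ, 0 < c ∧ u = c • v := by
  have hκ : κ' = κ := le_antisymm (hT.eigenvalue_le h he hu hu0 hTu hv hv0 hTv)
    (hT.eigenvalue_le h he hv hv0 hTv hu hu0 hTu)
  subst hκ
  refine ⟨rfl, ?_⟩
  have he0 := h.unit_nonneg
  have hℓu := hT.functional_pos u hu hu0
  have hℓv := hT.functional_pos v hv hv0
  obtain ⟨hκ', ε, hε, hεu⟩ := hT.eigenvector_comparable h he hu hu0 hTu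
  -- Subtract from `u` the largest possible multiple of `v`. A nonzero remainder would be a
  -- nonnegative eigenvector, hence would dominate a further positive multiple of `v`, contradicting
  -- maximality.
  let S : Set ℝ := {m | m • v ≤ u}
  have hvn : 0 < ‖v‖ := norm_pos_iff.2 hv0
  have hS1 : ε / ‖v‖ ∈ S := by
    calc (ε / ‖v‖) • v ≤ (ε / ‖v‖) • ‖v‖ • e :=
          smul_le_smul_of_nonneg_left (h.le_norm_smul v) (by positivity)
      _ = ε • e := by rw [smul_smul]; congr 1; field_simp
      _ ≤ u := hεu
  have hSb : BddAbove S := by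
    refine ⟨ℓ u / ℓ v, fun m hm => ?_⟩
    have := hT.functional_mono hm
    rw [map_smul, smul_eq_mul] at this
    rwa [le_div_iff₀ hℓv]
  have hSc : IsClosed S := by
    have : S = (fun m : ℝ => u - m • v) ⁻¹' {w | 0 ≤ w} := by
      ext m; simp [S]
    rw [this]
    exact h.isClosed_nonneg.preimage (by fun_prop)
  have hsup : sSup S ∈ S := hSc.csSup_mem ⟨_, hS1⟩ hSb
  have hpos : 0 < sSup S := lt_of_lt_of_le (by positivity) (le_csSup hSb hS1)
  refine ⟨sSup S, hpos, ?_⟩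
  by_contra hne
  have hw : 0 ≤ u - sSup S • v := sub_nonneg.2 hsup
  have hw0 : u - sSup S • v ≠ 0 := sub_ne_zero.2 hne
  have hTw : T (u - sSup S • v) = κ' • (u - sSup S • v) := by
    rw [map_sub, map_smul, hTu, hTv, smul_sub, smul_comm]
  obtain ⟨-, η, hη, hηw⟩ := hT.eigenvector_comparable h he hw hw0 hTw
  have : sSup S + η / ‖v‖ ∈ S := by
    change (sSup S + η / ‖v‖) • v ≤ u
    rw [add_smul, ← le_sub_iff_add_le']
    calc (η / ‖v‖) • v ≤ (η / ‖v‖) • ‖v‖ • e :=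
          smul_le_smul_of_nonneg_left (h.le_norm_smul v) (by positivity)
      _ = η • e := by rw [smul_smul]; congr 1; field_simp
      _ ≤ _ := hηw
  have := le_csSup hSb this
  have : 0 < η / ‖v‖ := by positivity
  linarith

end IsRankOneComparable

/-! ### Growth of powers and the spectral radius. -/

section Gelfand

variable {F : E →L[ℝ] E} {lam ε : ℝ} {v : E}

theorem pow_apply_eigenvector (hFv : F v = lam • v) (n : ℕ) : (F ^ n) v = lam ^ n • v := by
  induction n with
  | zero => simp
  | succ n ih =>
    rw [pow_succ', mul_apply_eq_comp, ih, map_smul, hFv, smul_smul, pow_succ]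

theorem le_norm_pow_of_eigenvector (hlam : 0 < lam) (hv0 : v ≠ 0) (hFv : F v = lam • v) (n : ℕ) :
    lam ^ n ≤ ‖F ^ n‖ := by
  have := (F ^ n).le_opNorm v
  rw [pow_apply_eigenvector hFv, norm_smul, Real.norm_of_nonneg (by positivity)] at this
  exact le_of_mul_le_mul_right this (norm_pos_iff.2 hv0)

/-- The unit ball lies in the order interval between `-ε⁻¹ • v` and `ε⁻¹ • v`, which a positive
operator with eigenvector `v` merely rescales. -/
theorem IsOrderUnitNorm.norm_pow_le (h : IsOrderUnitNorm e) (hF : ∀ u, 0 ≤ u → 0 ≤ F u)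
    (hlam : 0 < lam) (hε : 0 < ε) (hv : ε • e ≤ v) (hFv : F v = lam • v) (n : ℕ) :
    ‖F ^ n‖ ≤ ‖v‖ / ε * lam ^ n := by
  have hFn (u : E) (hu : 0 ≤ u) : 0 ≤ (F ^ n) u := by
    induction n with
    | zero => simpa using hu
    | succ n ih => rw [pow_succ', mul_apply_eq_comp]; exact hF _ ih
  have hmono {u w : E} (huw : u ≤ w) : (F ^ n) u ≤ (F ^ n) w := by
    have := hFn _ (sub_nonneg.2 huw)
    rwa [map_sub, sub_nonneg] at this
  refine ContinuousLinearMap.opNorm_le_bound _ (by positivity) fun u => ?_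
  have hev : ‖u‖ • e ≤ (‖u‖ / ε) • v := by
    calc ‖u‖ • e = (‖u‖ / ε) • ε • e := by rw [smul_smul]; congr 1; field_simp
      _ ≤ _ := smul_le_smul_of_nonneg_left hv (by positivity)
  obtain ⟨h1, h2⟩ := (h u _ (norm_nonneg u)).1 le_rfl
  have k1 := hmono ((neg_le_neg hev).trans h1)
  have k2 := hmono (h2.trans hev)
  have hb : (F ^ n) ((‖u‖ / ε) • v) ≤ (‖v‖ / ε * lam ^ n * ‖u‖) • e := by
    rw [map_smul, pow_apply_eigenvector hFv]
    calc (‖u‖ / ε) • lam ^ n • v ≤ (‖u‖ / ε) • lam ^ n • ‖v‖ • e := by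
          refine smul_le_smul_of_nonneg_left (smul_le_smul_of_nonneg_left (h.le_norm_smul v) ?_) ?_
            <;> positivity
      _ = _ := by rw [smul_smul, smul_smul]; congr 1; field_simp
  refine (h _ _ (by positivity)).2 ⟨?_, k2.trans hb⟩
  rw [map_neg] at k1
  exact (neg_le_neg hb).trans k1

theorem IsOrderUnitNorm.tendsto_norm_pow (h : IsOrderUnitNorm e) (hF : ∀ u, 0 ≤ u → 0 ≤ F u)
    (hlam : 0 < lam) (hε : 0 < ε) (hv : ε • e ≤ v) (hv0 : v ≠ 0) (hFv : F v = lam • v) :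
    Tendsto (fun n : ℕ => ‖F ^ n‖ ^ (1 / (n : ℝ))) atTop (𝓝 lam) := by
  have hvn : 0 < ‖v‖ := norm_pos_iff.2 hv0
  have hroot (n : ℕ) (hn : n ≠ 0) : (lam ^ n) ^ (1 / (n : ℝ)) = lam := by
    rw [one_div]; exact Real.pow_rpow_inv_natCast hlam.le hn
  have hup : Tendsto (fun n : ℕ => (‖v‖ / ε) ^ (1 / (n : ℝ)) * lam) atTop (𝓝 lam) := by
    have : Tendsto (fun n : ℕ => (‖v‖ / ε) ^ (1 / (n : ℝ))) atTop (𝓝 ((‖v‖ / ε) ^ (0 : ℝ))) :=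
      ((Real.continuous_const_rpow (by positivity)).tendsto 0).comp
        tendsto_one_div_atTop_nhds_zero_nat
    simpa using this.mul_const lam
  refine tendsto_of_tendsto_of_tendsto_of_le_of_le' tendsto_const_nhds hup ?_ ?_
  · filter_upwards [eventually_ne_atTop 0] with n hn
    calc lam = (lam ^ n) ^ (1 / (n : ℝ)) := (hroot n hn).symm
      _ ≤ _ := Real.rpow_le_rpow (by positivity) (le_norm_pow_of_eigenvector hlam hv0 hFv n)
        (by positivity)
  · filter_upwards [eventually_ne_atTop 0] with n hn
    calc ‖F ^ n‖ ^ (1 / (n : ℝ)) ≤ (‖v‖ / ε * lam ^ n) ^ (1 / (n : ℝ)) :=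
          Real.rpow_le_rpow (by positivity) (h.norm_pow_le hF hlam hε hv hFv n) (by positivity)
      _ = _ := by rw [Real.mul_rpow (by positivity) (by positivity), hroot n hn]

/-- Over ℝ only the upper bound by the growth of the powers is automatic, as the real spectrum may
be too small. Equality holds because `lam` is itself an eigenvalue. -/
theorem spectralRadius_eq_of_tendsto [CompleteSpace E] (hlam : 0 < lam) (hv0 : v ≠ 0)
    (hFv : F v = lam • v)
    (hlim : Tendsto (fun n : ℕ => ‖F ^ n‖ ^ (1 / (n : ℝ))) atTop (𝓝 lam)) :
    spectralRadius ℝ F = ENNReal.ofReal lam := by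
  refine le_antisymm ?_ ?_
  · refine (spectrum.spectralRadius_le_liminf_pow_nnnorm_pow_one_div ℝ F).trans (le_of_eq ?_)
    refine Tendsto.liminf_eq ?_
    have := (ENNReal.continuous_ofReal.tendsto lam).comp hlim
    refine this.congr fun n => ?_
    rw [Function.comp_apply, ← ENNReal.ofReal_rpow_of_nonneg (norm_nonneg _) (by positivity),
      ofReal_norm]
    rfl
  · have hmem : lam ∈ spectrum ℝ F := by
      rw [spectrum.mem_iff]
      rintro ⟨w, hw⟩
      apply hv0
      have h1 : (algebraMap ℝ (E →L[ℝ] E) lam - F) v = 0 := by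
        rw [sub_apply, hFv, Algebra.algebraMap_eq_smul_one]
        simp
      rw [← hw] at h1
      have h2 : ((↑w⁻¹ * ↑w : E →L[ℝ] E)) v = 0 := by
        rw [mul_apply_eq_comp, h1, map_zero]
      simpa using h2
    have := le_iSup₂ (f := fun k (_ : k ∈ spectrum ℝ F) => (‖k‖₊ : ℝ≥0∞)) lam hmem
    refine le_trans (le_of_eq ?_) this
    change ENNReal.ofReal lam = ‖lam‖ₑ
    rw [← ofReal_norm, Real.norm_of_nonneg hlam.le]

end Gelfand

/-- A Perron–Frobenius theorem: if some power of a positive operator is comparable to a rank one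
operator, then the operator has a unique nonnegative eigenvector, and the eigenvalue is the
spectral radius. -/
theorem IsOrderUnitNorm.perron_frobenius [CompleteSpace E] (h : IsOrderUnitNorm e) (he : e ≠ 0)
    {F : E →L[ℝ] E} (hF : ∀ u, 0 ≤ u → 0 ≤ F u) {N : ℕ} (hN : N ≠ 0) {ℓ : E →ₗ[ℝ] ℝ} {c C : ℝ}
    (hT : IsRankOneComparable e (F ^ N) ℓ c C) :
    ∃ (lam : ℝ) (v : E), 0 < lam ∧ F v = lam • v ∧ (∃ ε : ℝ, 0 < ε ∧ ε • e ≤ v) ∧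
      spectralRadius ℝ F = ENNReal.ofReal lam ∧
      Tendsto (fun n : ℕ => ‖F ^ n‖ ^ (1 / (n : ℝ))) atTop (𝓝 lam) ∧
      ∀ (u : E) (κ : ℝ), u ≠ 0 → 0 ≤ u → F u = κ • u → κ = lam ∧ ∃ c : ℝ, 0 < c ∧ u = c • v := by
  obtain ⟨κ, v, hκ, hv, hv0, hTv⟩ := hT.exists_eigenvector h he
  obtain ⟨-, ε, hε, hεv⟩ := hT.eigenvector_comparable h he hv hv0 hTv
  -- `F v` is again a nonnegative eigenvector of `F ^ N`, so uniqueness makes it a multiple of `v`.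
  have hcomm : (F ^ N) (F v) = F ((F ^ N) v) := by
    rw [← mul_apply_eq_comp, ← mul_apply_eq_comp, pow_mul_comm']
  have hFv0 : F v ≠ 0 := by
    intro h0
    obtain ⟨N, rfl⟩ := Nat.exists_eq_succ_of_ne_zero hN
    rw [pow_succ, mul_apply_eq_comp, h0, map_zero] at hTv
    exact smul_ne_zero hκ.ne' hv0 hTv.symm
  obtain ⟨-, lam, hlam, hFv⟩ := hT.eigenvector_unique h he hv hv0 hTv (hF v hv) hFv0
    (show (F ^ N) (F v) = κ • F v by rw [hcomm, hTv, map_smul])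
  have hlim := h.tendsto_norm_pow hF hlam hε hεv hv0 hFv
  refine ⟨lam, v, hlam, hFv, ⟨ε, hε, hεv⟩, spectralRadius_eq_of_tendsto hlam hv0 hFv hlim, hlim, ?_⟩
  intro u κ' hu0 hu hFu
  obtain ⟨-, c, hc, rfl⟩ := hT.eigenvector_unique h he hv hv0 hTv hu hu0
    (pow_apply_eigenvector hFu N)
  refine ⟨?_, c, hc, rfl⟩
  rw [map_smul, hFv, smul_smul, smul_smul] at hFu
  have := smul_left_injective ℝ hv0 hFu
  exact mul_left_cancel₀ hc.ne' (by linarith)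

end OrderUnit

/-! ### The continuous density of the denominator. -/

theorem IsRegularDensity.pos {L : ℝ} {ρ : ℝ → ℝ} (h : IsRegularDensity L ρ) (x : ℝ) : 0 < ρ x := by
  obtain ⟨c, hc, hcx⟩ := h.locally_pos (|x| + 1) (by positivity)
  exact hc.trans_le (hcx x (lt_add_one _))

theorem IsRegularDensity.continuous {L : ℝ} {ρ : ℝ → ℝ} (h : IsRegularDensity L ρ) :
    Continuous ρ := h.differentiable.continuous

theorem IsRegularDensity.le {L : ℝ} {ρ : ℝ → ℝ} (h : IsRegularDensity L ρ) (hL : 0 < L) (x : ℝ) :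
    ρ x ≤ L :=
  (h.upper x).trans (mul_le_of_le_one_right hL.le (inv_le_one_of_one_le₀ (by nlinarith [sq_nonneg x])))

/-- The continuous version of the density of `denominatorLaw ρ t E M μ`. -/
noncomputable def iterDensity (ρ : ℝ → ℝ) (t E : ℝ) (M : ℕ) (μ : Measure ℝ) (x : ℝ) : ℝ :=
  ∫ γ, ρ (x + E + t ^ 2 * ∑ i, γ i) ∂(Measure.pi fun _ : Fin M => μ)

namespace IsRegularDensity

variable {L : ℝ} {ρ : ℝ → ℝ} (hρ : IsRegularDensity L ρ) (hL : 0 < L) (t E : ℝ) (μ : Measure ℝ)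
  [IsProbabilityMeasure μ]
include hρ hL

theorem integrable_comp_sum (M : ℕ) (x : ℝ) :
    Integrable (fun γ => ρ (x + E + t ^ 2 * ∑ i, γ i)) (Measure.pi fun _ : Fin M => μ) := by
  refine Integrable.of_bound (C := L) ?_ (ae_of_all _ fun γ => ?_)
  · exact (hρ.continuous.comp (by fun_prop)).aestronglyMeasurable
  · rw [Real.norm_of_nonneg (hρ.nonneg _)]
    exact hρ.le hL _

theorem iterDensity_pos (M : ℕ) (x : ℝ) : 0 < iterDensity ρ t E M μ x := by
  unfold iterDensity
  rw [integral_pos_iff_support_of_nonneg (fun γ => hρ.nonneg _)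
    (hρ.integrable_comp_sum hL t E μ M x)]
  have : (Function.support fun γ : Fin M → ℝ => ρ (x + E + t ^ 2 * ∑ i, γ i)) = Set.univ :=
    Set.eq_univ_of_forall fun γ => (hρ.pos _).ne'
  rw [this]
  simp

theorem iterDensity_le (M : ℕ) (x : ℝ) : iterDensity ρ t E M μ x ≤ L := by
  calc iterDensity ρ t E M μ x ≤ ∫ _, L ∂(Measure.pi fun _ : Fin M => μ) :=
        integral_mono (hρ.integrable_comp_sum hL t E μ M x) (integrable_const _)
          fun γ => hρ.le hL _
    _ = L := by simp

theorem continuous_iterDensity (M : ℕ) : Continuous (iterDensity ρ t E M μ) := by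
  unfold iterDensity
  refine continuous_of_dominated (bound := fun _ => L) (fun x => ?_) (fun x => ?_)
    (integrable_const _) (ae_of_all _ fun γ => hρ.continuous.comp (by fun_prop))
  · exact (hρ.integrable_comp_sum hL t E μ M x).aestronglyMeasurable
  · refine ae_of_all _ fun γ => ?_
    rw [Real.norm_of_nonneg (hρ.nonneg _)]
    exact hρ.le hL _

omit hρ hL in
theorem iterDensity_zero (x : ℝ) : iterDensity ρ t E 0 μ x = ρ (x + E) := by
  simp [iterDensity]

/-- Splitting off one coordinate of the product measure allows induction on the number of copies of
Γ. -/
theorem iterDensity_succ (M : ℕ) (x : ℝ) :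
    iterDensity ρ t E (M + 1) μ x = ∫ γ, iterDensity ρ t E M μ (x + t ^ 2 * γ) ∂μ := by
  unfold iterDensity
  have hmp := (measurePreserving_piFinSuccAbove (fun _ : Fin (M + 1) => μ) 0).symm
  rw [← hmp.integral_comp', integral_prod]
  · refine integral_congr_ae (ae_of_all _ fun γ => integral_congr_ae (ae_of_all _ fun η => ?_))
    simp only [MeasurableEquiv.piFinSuccAbove_symm_apply, Fin.sum_univ_succ, Fin.insertNthEquiv,
      Equiv.coe_fn_mk, Fin.insertNth_zero, Fin.cons_zero, Fin.cons_succ,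
      Fin.zero_succAbove, cast_eq]
    congr 1
    ring
  · exact (hmp.integrable_comp_emb (MeasurableEquiv.measurableEmbedding _)).2
      (hρ.integrable_comp_sum hL t E μ (M + 1) x)

/-- Against a test function, translate the variable `V₀` for fixed values of the other variables,
then exchange the integrals. -/
theorem denominatorLaw_eq (M : ℕ) :
    denominatorLaw ρ t E M μ
      = volume.withDensity fun x => ENNReal.ofReal (iterDensity ρ t E M μ x) := by
  have hm : Measurable ρ := hρ.continuous.measurable
  refine Measure.ext_of_lintegral _ fun g hg => ?_
  unfold denominatorLaw
  rw [lintegral_map hg (by fun_prop), lintegral_prod_symm' _ (by fun_prop)]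
  have h1 (γ : Fin M → ℝ) :
      ∫⁻ v, g (v - E - t ^ 2 * ∑ i, γ i) ∂(volume.withDensity fun x => ENNReal.ofReal (ρ x))
        = ∫⁻ x, ENNReal.ofReal (ρ (x + E + t ^ 2 * ∑ i, γ i)) * g x := by
    rw [lintegral_withDensity_eq_lintegral_mul _ (by fun_prop) (by fun_prop),
      ← lintegral_add_right_eq_self _ (E + t ^ 2 * ∑ i, γ i)]
    refine lintegral_congr fun x => ?_
    simp only [Pi.mul_apply]
    ring_nf
  simp only [h1]
  rw [lintegral_lintegral_swap (by fun_prop),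
    lintegral_withDensity_eq_lintegral_mul _
      (hρ.continuous_iterDensity hL t E μ M).measurable.ennreal_ofReal hg]
  refine lintegral_congr fun x => ?_
  rw [lintegral_mul_const _ (by fun_prop), Pi.mul_apply, iterDensity,
    ofReal_integral_eq_lintegral_ofReal (hρ.integrable_comp_sum hL t E μ M x)
      (ae_of_all _ fun γ => hρ.nonneg _)]

theorem selfEnergyDensity_ae (K : ℕ) :
    selfEnergyDensity ρ K t E μ =ᵐ[volume] iterDensity ρ t E (K - 1) μ := by
  unfold selfEnergyDensity
  rw [hρ.denominatorLaw_eq hL]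
  filter_upwards [Measure.rnDeriv_withDensity volume
    (hρ.continuous_iterDensity hL t E μ (K - 1)).measurable.ennreal_ofReal] with x hx
  rw [hx, ENNReal.toReal_ofReal (hρ.iterDensity_pos hL t E μ _ x).le]

end IsRegularDensity

/-! ### Cauchy tails from the recursive equation. -/

/-- Change of variables `x = k / z` on the line. -/
theorem lintegral_comp_const_div {k : ℝ} (hk : k ≠ 0) (g : ℝ → ℝ≥0∞) :
    ∫⁻ x, g x = ∫⁻ z, ENNReal.ofReal (|k| * (z ^ 2)⁻¹) * g (k / z) := by
  have himg : (fun z : ℝ => k / z) '' {0}ᶜ = {0}ᶜ := by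
    ext x
    simp only [Set.mem_image, Set.mem_compl_iff, Set.mem_singleton_iff]
    refine ⟨?_, fun hx => ⟨k / x, by positivity, by field_simp⟩⟩
    rintro ⟨z, hz, rfl⟩
    positivity
  have hinj : Set.InjOn (fun z : ℝ => k / z) {0}ᶜ := by
    intro x hx y hy hxy
    simp only [Set.mem_compl_iff, Set.mem_singleton_iff] at hx hy
    field_simp at hxy
    exact hxy.symm
  have hd (x : ℝ) (hx : x ∈ ({0}ᶜ : Set ℝ)) :
      HasDerivWithinAt (fun z : ℝ => k / z) (-k / x ^ 2) {0}ᶜ x := by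
    have := ((hasDerivAt_inv (show x ≠ 0 from hx)).const_mul k).hasDerivWithinAt (s := {0}ᶜ)
    exact this.congr_deriv (by ring)
  have := lintegral_image_eq_lintegral_abs_deriv_mul (measurableSet_singleton 0).compl hd hinj g
  rw [himg] at this
  simp only [restrict_compl_singleton] at this
  rw [this]
  refine lintegral_congr fun z => ?_
  rw [abs_div, abs_neg, abs_of_nonneg (sq_nonneg z), div_eq_mul_inv]

/-- Inverting the denominator shows that `μ` has a density. The Jacobian `(z ^ 2)⁻¹` is the source
of all Cauchy tails below. -/
theorem SolvesRDE.lintegral_eq {L : ℝ} {ρ : ℝ → ℝ} (hρ : IsRegularDensity L ρ) (hL : 0 < L)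
    {t E : ℝ} {K : ℕ} {μ : Measure ℝ} [IsProbabilityMeasure μ] (hμ : SolvesRDE ρ K t E μ)
    {g : ℝ → ℝ≥0∞} (hg : Measurable g) :
    ∫⁻ z, g z ∂μ = ∫⁻ z, ENNReal.ofReal (iterDensity ρ t E K μ z⁻¹ * (z ^ 2)⁻¹) * g z := by
  conv_lhs => rw [hμ]
  have hm : Measurable (iterDensity ρ t E K μ) := (hρ.continuous_iterDensity hL t E μ K).measurable
  rw [lintegral_map hg measurable_inv, hρ.denominatorLaw_eq hL,
    lintegral_withDensity_eq_lintegral_mul _ (by fun_prop) (by fun_prop),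
    lintegral_comp_const_div one_ne_zero]
  refine lintegral_congr fun z => ?_
  have := (hρ.iterDensity_pos hL t E μ K z⁻¹).le
  simp only [Pi.mul_apply, abs_one, one_mul, one_div, inv_inv]
  rw [← mul_assoc, ← ENNReal.ofReal_mul (by positivity), mul_comm (iterDensity _ _ _ _ _ _)]

/-- A lower bound for the integral of a function that is bounded below on an interval of length
one which lies at distance `d` from `0` on the side of `-X`, next to `-X`. -/
theorem le_lintegral_of_window (X d : ℝ) {g : ℝ → ℝ≥0∞} {κ : ℝ≥0∞}
    (h : ∀ z, d ≤ |z| → |z| ≤ |X| + d + 1 → |z + X| ≤ d + 1 → 0 ≤ d → κ ≤ g z) (hd : 0 ≤ d) :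
    κ ≤ ∫⁻ z, g z := by
  have key (a : ℝ) (ha : ∀ z ∈ Set.Icc a (a + 1), κ ≤ g z) : κ ≤ ∫⁻ z, g z := by
    calc κ = ∫⁻ _ in Set.Icc a (a + 1), κ := by simp
      _ ≤ ∫⁻ z in Set.Icc a (a + 1), g z := setLIntegral_mono' measurableSet_Icc ha
      _ ≤ _ := setLIntegral_le_lintegral _ _
  rcases le_total X 0 with hX | hX
  · refine key (-X + d) fun z hz => h z ?_ ?_ ?_ hd
    · rw [abs_of_nonneg (by linarith [hz.1])]; linarith [hz.1]
    · rw [abs_of_nonneg (by linarith [hz.1]), abs_of_nonpos hX]; linarith [hz.2]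
    · rw [abs_of_nonneg (by linarith [hz.1])]; linarith [hz.2]
  · refine key (-X - d - 1) fun z hz => h z ?_ ?_ ?_ hd
    · rw [abs_of_nonpos (by linarith [hz.2])]; linarith [hz.2]
    · rw [abs_of_nonpos (by linarith [hz.2]), abs_of_nonneg hX]; linarith [hz.1]
    · rw [abs_of_nonpos (by linarith [hz.2])]; linarith [hz.1]

theorem exists_pos_le_of_continuous {f : ℝ → ℝ} (hf : Continuous f) (hpos : ∀ x, 0 < f x)
    (R : ℝ) : ∃ c : ℝ, 0 < c ∧ ∀ x, |x| ≤ R → c ≤ f x := by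
  rcases lt_or_ge R 0 with hR | hR
  · exact ⟨1, one_pos, fun x hx => absurd (abs_nonneg x) (by linarith)⟩
  · obtain ⟨x₀, -, hx₀⟩ := (isCompact_Icc (a := -R) (b := R)).exists_isMinOn
      ⟨0, by simp [hR]⟩ hf.continuousOn
    exact ⟨f x₀, hpos _, fun x hx => hx₀ (abs_le.1 hx)⟩

theorem inv_one_add_sq_le_of_half_le {x y : ℝ} (h : |x| / 2 ≤ |y|) :
    (1 + y ^ 2)⁻¹ ≤ 4 * (1 + x ^ 2)⁻¹ := by
  rw [← div_eq_mul_inv, inv_eq_one_div, div_le_div_iff₀ (by positivity) (by positivity)]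
  have : (|x| / 2) ^ 2 ≤ |y| ^ 2 := pow_le_pow_left₀ (by positivity) h 2
  rw [div_pow, sq_abs, sq_abs] at this
  linarith

/-- Peetre's inequality. -/
theorem inv_one_add_sq_add_le (x y : ℝ) :
    (1 + (x + y) ^ 2)⁻¹ ≤ 2 * (1 + y ^ 2) * (1 + x ^ 2)⁻¹ := by
  rw [← div_eq_mul_inv, inv_eq_one_div, div_le_div_iff₀ (by positivity) (by positivity)]
  nlinarith [sq_nonneg (x + 2 * y), sq_nonneg (y * (x + y)), sq_nonneg x, sq_nonneg y]

namespace IsRegularDensity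

variable {L : ℝ} {ρ : ℝ → ℝ} (hρ : IsRegularDensity L ρ) (hL : 0 < L) {t E : ℝ} (ht : 0 < t)
  {K : ℕ} {μ : Measure ℝ} [IsProbabilityMeasure μ] (hμ : SolvesRDE ρ K t E μ)
include hρ hL ht hμ

omit ht in
theorem ofReal_iterDensity_succ (M : ℕ) (x : ℝ) :
    ENNReal.ofReal (iterDensity ρ t E (M + 1) μ x)
      = ∫⁻ z, ENNReal.ofReal (iterDensity ρ t E K μ z⁻¹ * (z ^ 2)⁻¹) *
          ENNReal.ofReal (iterDensity ρ t E M μ (x + t ^ 2 * z)) := by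
  have hc := hρ.continuous_iterDensity hL t E μ M
  have hm : Measurable (iterDensity ρ t E M μ) := hc.measurable
  rw [hρ.iterDensity_succ hL, ofReal_integral_eq_lintegral_ofReal,
    hμ.lintegral_eq hρ hL (by fun_prop)]
  · refine Integrable.of_bound (C := L) (by fun_prop) (ae_of_all _ fun γ => ?_)
    rw [Real.norm_of_nonneg (hρ.iterDensity_pos hL t E μ M _).le]
    exact hρ.iterDensity_le hL t E μ M _
  · exact ae_of_all _ fun γ => (hρ.iterDensity_pos hL t E μ M _).le

/-- For `x + t ^ 2 * z` to be small compared with `x`, the value `z` of the added Γ must be of order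
at least `x`. There the density of Γ is at most `L / z ^ 2`, which needs only the uniform bound on
the density with index `K`, so the induction on `M` is not circular. -/
theorem exists_iterDensity_le (M : ℕ) :
    ∃ C : ℝ, 0 < C ∧ ∀ x, iterDensity ρ t E M μ x ≤ C * (1 + x ^ 2)⁻¹ := by
  induction M with
  | zero =>
    refine ⟨L * (2 * (1 + E ^ 2)), by positivity, fun x => ?_⟩
    rw [iterDensity_zero]
    calc ρ (x + E) ≤ L * (1 + (x + E) ^ 2)⁻¹ := hρ.upper _
      _ ≤ L * (2 * (1 + E ^ 2) * (1 + x ^ 2)⁻¹) :=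
          mul_le_mul_of_nonneg_left (inv_one_add_sq_add_le x E) hL.le
      _ = _ := by ring
  | succ M ih =>
    obtain ⟨C, hC, hCx⟩ := ih
    have hmK : Measurable (iterDensity ρ t E K μ) :=
      (hρ.continuous_iterDensity hL t E μ K).measurable
    have hone : ∫⁻ z, ENNReal.ofReal (iterDensity ρ t E K μ z⁻¹ * (z ^ 2)⁻¹) = 1 := by
      have := hμ.lintegral_eq hρ hL (g := fun _ => 1) measurable_const
      simpa using this.symm
    have hint (x : ℝ) : ∫⁻ z, ENNReal.ofReal ((1 + (x + t ^ 2 * z) ^ 2)⁻¹)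
        = ENNReal.ofReal ((t ^ 2)⁻¹ * Real.pi) := by
      rw [← ofReal_integral_eq_lintegral_ofReal]
      · have h1 := Measure.integral_comp_mul_left (fun y : ℝ => (1 + (x + y) ^ 2)⁻¹) (t ^ 2)
        rw [h1, integral_add_left_eq_self (fun y : ℝ => (1 + y ^ 2)⁻¹),
          integral_univ_inv_one_add_sq, abs_of_nonneg (by positivity), smul_eq_mul]
      · exact (integrable_inv_one_add_sq.comp_add_left x).comp_mul_left' (by positivity)
      · exact ae_of_all _ fun z => by positivity
    refine ⟨4 * C + 8 * L * t ^ 4 * C * ((t ^ 2)⁻¹ * Real.pi), by positivity, fun x => ?_⟩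
    have hpt (z : ℝ) : ENNReal.ofReal (iterDensity ρ t E K μ z⁻¹ * (z ^ 2)⁻¹) *
          ENNReal.ofReal (iterDensity ρ t E M μ (x + t ^ 2 * z)) ≤
        ENNReal.ofReal (iterDensity ρ t E K μ z⁻¹ * (z ^ 2)⁻¹) *
          ENNReal.ofReal (4 * C * (1 + x ^ 2)⁻¹) +
        ENNReal.ofReal (8 * L * t ^ 4 * C * (1 + x ^ 2)⁻¹) *
          ENNReal.ofReal ((1 + (x + t ^ 2 * z) ^ 2)⁻¹) := by
      -- In the first case the induction hypothesis supplies the decay in `x`; in the second the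
      -- factor `(z ^ 2)⁻¹` does, and the induction hypothesis supplies integrability in `z`.
      by_cases hcase : |x| ≤ 1 ∨ |x| / 2 ≤ |x + t ^ 2 * z|
      · refine le_add_right ?_
        gcongr
        refine (hCx _).trans ?_
        rw [mul_comm 4 C, mul_assoc]
        refine mul_le_mul_of_nonneg_left ?_ hC.le
        rcases hcase with hx | hx
        · have h1 : (1 + (x + t ^ 2 * z) ^ 2)⁻¹ ≤ 1 :=
            inv_le_one_of_one_le₀ (by nlinarith [sq_nonneg (x + t ^ 2 * z)])
          refine h1.trans ?_
          rw [← div_eq_mul_inv, le_div_iff₀ (by positivity)]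
          have := (sq_le_one_iff_abs_le_one x).2 hx
          linarith
        · exact inv_one_add_sq_le_of_half_le hx
      · push Not at hcase
        obtain ⟨hx1, hx2⟩ := hcase
        refine le_add_left ?_
        have hp := hρ.iterDensity_pos hL t E μ K z⁻¹
        rw [← ENNReal.ofReal_mul (by positivity), ← ENNReal.ofReal_mul (by positivity)]
        refine ENNReal.ofReal_le_ofReal ?_
        have htz : |x| / 2 ≤ t ^ 2 * |z| := by
          have := abs_sub_abs_le_abs_add x (t ^ 2 * z)
          rw [abs_mul, abs_of_nonneg (sq_nonneg t)] at this
          linarith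
        have hz : x ^ 2 ≤ 4 * t ^ 4 * z ^ 2 := by
          have := pow_le_pow_left₀ (by positivity) htz 2
          rw [div_pow, sq_abs, mul_pow, sq_abs] at this
          linarith
        have hx1' : 1 < x ^ 2 := (one_lt_sq_iff_one_lt_abs x).2 hx1
        have hz0 : 0 < z ^ 2 := by
          by_contra! h0
          have : 0 < 4 * t ^ 4 := by positivity
          nlinarith
        have hzi : (z ^ 2)⁻¹ ≤ 8 * t ^ 4 * (1 + x ^ 2)⁻¹ := by
          rw [← div_eq_mul_inv, inv_eq_one_div, div_le_div_iff₀ hz0 (by positivity)]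
          linarith
        calc iterDensity ρ t E K μ z⁻¹ * (z ^ 2)⁻¹ * iterDensity ρ t E M μ (x + t ^ 2 * z)
            ≤ L * (8 * t ^ 4 * (1 + x ^ 2)⁻¹) * (C * (1 + (x + t ^ 2 * z) ^ 2)⁻¹) := by
              refine mul_le_mul (mul_le_mul (hρ.iterDensity_le hL t E μ K _) hzi (by positivity)
                hL.le) (hCx _) (hρ.iterDensity_pos hL t E μ M _).le (by positivity)
          _ = _ := by ring
    have hfin : ENNReal.ofReal (iterDensity ρ t E (M + 1) μ x) ≤
        ENNReal.ofReal ((4 * C + 8 * L * t ^ 4 * C * ((t ^ 2)⁻¹ * Real.pi)) * (1 + x ^ 2)⁻¹) := by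
      rw [hρ.ofReal_iterDensity_succ hL hμ]
      refine (lintegral_mono hpt).trans ?_
      rw [lintegral_add_right _ (by fun_prop), lintegral_mul_const _ (by fun_prop),
        lintegral_const_mul _ (by fun_prop), hone, hint, one_mul,
        ← ENNReal.ofReal_mul (by positivity), ← ENNReal.ofReal_add (by positivity) (by positivity)]
      refine ENNReal.ofReal_le_ofReal (le_of_eq (by ring))
    exact (ENNReal.ofReal_le_ofReal_iff (by positivity)).1 hfin

/-- One Γ with a value near `-x / t ^ 2` brings the argument into a bounded set, at a cost of order
`z⁻²`. At least one copy is needed, since `ρ` itself may have lighter tails. -/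
theorem exists_le_iterDensity_succ (M : ℕ) :
    ∃ c : ℝ, 0 < c ∧ ∀ x, c * (1 + x ^ 2)⁻¹ ≤ iterDensity ρ t E (M + 1) μ x := by
  obtain ⟨c₁, hc₁, h1⟩ := exists_pos_le_of_continuous (hρ.continuous_iterDensity hL t E μ M)
    (hρ.iterDensity_pos hL t E μ M) (2 * t ^ 2)
  obtain ⟨c₂, hc₂, h2⟩ := exists_pos_le_of_continuous (hρ.continuous_iterDensity hL t E μ K)
    (hρ.iterDensity_pos hL t E μ K) 1
  refine ⟨c₂ * (2 / t ^ 4 + 8)⁻¹ * c₁, by positivity, fun x => ?_⟩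
  refine (ENNReal.ofReal_le_ofReal_iff (hρ.iterDensity_pos hL t E μ _ _).le).1 ?_
  rw [hρ.ofReal_iterDensity_succ hL hμ]
  refine le_lintegral_of_window (x / t ^ 2) 1 (fun z hz1 hz2 hz3 _ => ?_) zero_le_one
  have hp := hρ.iterDensity_pos hL t E μ K z⁻¹
  rw [← ENNReal.ofReal_mul (by positivity)]
  refine ENNReal.ofReal_le_ofReal ?_
  have hz0 : 0 < z ^ 2 := by rw [← sq_abs]; positivity
  have hzi : |z⁻¹| ≤ 1 := by rw [abs_inv]; exact inv_le_one_of_one_le₀ hz1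
  have hxz : |x + t ^ 2 * z| ≤ 2 * t ^ 2 := by
    have : x + t ^ 2 * z = t ^ 2 * (z + x / t ^ 2) := by field_simp; ring
    rw [this, abs_mul, abs_of_pos (by positivity)]
    have : t ^ 2 * |z + x / t ^ 2| ≤ t ^ 2 * (1 + 1) := by gcongr
    linarith
  have hz : z ^ 2 ≤ (2 / t ^ 4 + 8) * (1 + x ^ 2) := by
    have h3 : |z| ^ 2 ≤ (|x / t ^ 2| + 2) ^ 2 :=
      pow_le_pow_left₀ (abs_nonneg z) (by linarith) 2
    have h4 : |x / t ^ 2| ^ 2 = x ^ 2 / t ^ 4 := by rw [sq_abs, div_pow]; ring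
    have h5 : (2 / t ^ 4 + 8) * (1 + x ^ 2) = 2 * (x ^ 2 / t ^ 4) + 8 + (2 / t ^ 4 + 8 * x ^ 2) := by
      ring
    have h6 : 0 ≤ 2 / t ^ 4 + 8 * x ^ 2 := by positivity
    rw [sq_abs] at h3
    nlinarith [sq_nonneg (|x / t ^ 2| - 2)]
  calc c₂ * (2 / t ^ 4 + 8)⁻¹ * c₁ * (1 + x ^ 2)⁻¹
      = c₂ * ((2 / t ^ 4 + 8) * (1 + x ^ 2))⁻¹ * c₁ := by rw [mul_inv]; ring
    _ ≤ iterDensity ρ t E K μ z⁻¹ * (z ^ 2)⁻¹ * iterDensity ρ t E M μ (x + t ^ 2 * z) := by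
      refine mul_le_mul (mul_le_mul (h2 _ hzi) (inv_anti₀ hz0 hz) (by positivity) hp.le)
        (h1 _ hxz) hc₁.le (by positivity)

end IsRegularDensity

/-! ### Elementary estimates for the weights. -/

/-- The density `p` is continuous and comparable to the Cauchy density. -/
structure IsCauchyComparable (p : ℝ → ℝ) (c C : ℝ) : Prop where
  continuous : Continuous p
  lower_pos : 0 < c
  lower : ∀ x, c * (1 + x ^ 2)⁻¹ ≤ p x
  upper : ∀ x, p x ≤ C * (1 + x ^ 2)⁻¹

/-- The weight of the functional to which powers of the transfer operator are comparable. -/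
noncomputable def decay (s y : ℝ) : ℝ := (1 + |y|) ^ (-s)

theorem decay_pos (s y : ℝ) : 0 < decay s y := by unfold decay; positivity

theorem continuous_decay (s : ℝ) : Continuous (decay s) := by
  unfold decay
  exact Continuous.rpow_const (by fun_prop) fun x => Or.inl (by positivity)

section WeightEstimates

variable {s : ℝ} (hs0 : 0 < s) (hs1 : s < 1)
include hs0 hs1

theorem inv_one_add_sq_le_weight_inv (x : ℝ) : (1 + x ^ 2)⁻¹ ≤ 2 * (weight s x)⁻¹ := by
  rw [← div_eq_mul_inv, inv_eq_one_div, div_le_div_iff₀ (by positivity) (weight_pos s x)]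
  have : |x| ^ (2 - s) ≤ 1 + x ^ 2 := by
    rcases le_total |x| 1 with h | h
    · have := Real.rpow_le_one (abs_nonneg x) h (show 0 ≤ 2 - s by linarith)
      nlinarith [sq_nonneg x]
    · have := Real.rpow_le_rpow_of_exponent_le h (show 2 - s ≤ 2 by linarith)
      rw [Real.rpow_two, sq_abs] at this
      linarith
  unfold weight
  nlinarith [sq_nonneg x]

theorem one_add_abs_rpow_le_weight (x : ℝ) : (1 + |x|) ^ (2 - s) ≤ 4 * weight s x := by
  have hr : 0 ≤ 2 - s := by linarith
  have h2 : (2 : ℝ) ^ (2 - s) ≤ 4 := by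
    have := Real.rpow_le_rpow_of_exponent_le one_le_two (show 2 - s ≤ 2 by linarith)
    rw [Real.rpow_two] at this
    linarith
  have hx : (max 1 |x|) ^ (2 - s) ≤ weight s x := by
    unfold weight
    have : 0 ≤ |x| ^ (2 - s) := by positivity
    rcases le_total |x| 1 with h | h
    · rw [max_eq_left h, Real.one_rpow]; linarith
    · rw [max_eq_right h]; linarith
  calc (1 + |x|) ^ (2 - s) ≤ (2 * max 1 |x|) ^ (2 - s) := by
        refine Real.rpow_le_rpow (by positivity) ?_ hr
        linarith [le_max_left 1 |x|, le_max_right 1 |x|]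
    _ = 2 ^ (2 - s) * (max 1 |x|) ^ (2 - s) := Real.mul_rpow (by norm_num) (by positivity)
    _ ≤ 4 * weight s x := by gcongr

theorem integrable_weight_inv : Integrable fun x => (weight s x)⁻¹ := by
  have h : Integrable fun x : ℝ => (1 + ‖x‖) ^ (-(2 - s)) :=
    integrable_one_add_norm (by rw [Module.finrank_self]; push_cast; linarith)
  refine (h.const_mul 4).mono' (measurable_weight s).inv.aestronglyMeasurable
    (ae_of_all _ fun x => ?_)
  have hw := weight_pos s x
  rw [Real.norm_of_nonneg (by positivity), Real.norm_eq_abs, Real.rpow_neg (by positivity),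
    ← div_eq_mul_inv, inv_eq_one_div, div_le_div_iff₀ hw (by positivity)]
  have := one_add_abs_rpow_le_weight hs0 hs1 x
  linarith

theorem inv_one_add_sq_le_decay (x : ℝ) : (1 + x ^ 2)⁻¹ ≤ 2 * decay s x := by
  unfold decay
  rw [Real.rpow_neg (by positivity), ← div_eq_mul_inv, inv_eq_one_div,
    div_le_div_iff₀ (by positivity) (by positivity)]
  have : (1 + |x|) ^ s ≤ (1 + |x|) ^ (1 : ℝ) :=
    Real.rpow_le_rpow_of_exponent_le (by linarith [abs_nonneg x]) hs1.le
  rw [Real.rpow_one] at this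
  nlinarith [sq_nonneg (|x| - 1), sq_abs x]

/-- Translating the argument of `decay` against an integrable loss. -/
theorem inv_one_add_sq_mul_decay_le (y z : ℝ) :
    (1 + (z + y) ^ 2)⁻¹ * decay s z ≤ 2 * (1 + |z + y|) ^ (-(2 - s)) * decay s y := by
  unfold decay
  have h1 : 1 + |y| ≤ (1 + |z|) * (1 + |z + y|) := by
    have := abs_sub_abs_le_abs_add y z
    rw [add_comm y z] at this
    nlinarith [mul_nonneg (abs_nonneg z) (abs_nonneg (z + y))]
  have h2 : (1 + |y|) ^ s ≤ (1 + |z|) ^ s * (1 + |z + y|) ^ s := by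
    rw [← Real.mul_rpow (by positivity) (by positivity)]
    exact Real.rpow_le_rpow (by positivity) h1 hs0.le
  have h3 : (1 + |z + y|) ^ s * (1 + |z + y|) ^ (2 - s) ≤ 2 * (1 + (z + y) ^ 2) := by
    rw [← Real.rpow_add (by positivity), add_sub_cancel, Real.rpow_two]
    nlinarith [sq_nonneg (|z + y| - 1), sq_abs (z + y)]
  have hz : 0 < (1 + |z|) ^ s := by positivity
  have hy : 0 < (1 + |y|) ^ s := by positivity
  have hv : 0 < (1 + |z + y|) ^ (2 - s) := by positivity
  rw [Real.rpow_neg (by positivity), Real.rpow_neg (by positivity), Real.rpow_neg (by positivity),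
    ← mul_inv, mul_assoc, ← mul_inv, ← div_eq_mul_inv, inv_eq_one_div,
    div_le_div_iff₀ (by positivity) (by positivity), one_mul]
  calc (1 + |z + y|) ^ (2 - s) * (1 + |y|) ^ s
      ≤ (1 + |z + y|) ^ (2 - s) * ((1 + |z|) ^ s * (1 + |z + y|) ^ s) := by gcongr
    _ = ((1 + |z + y|) ^ s * (1 + |z + y|) ^ (2 - s)) * (1 + |z|) ^ s := by ring
    _ ≤ 2 * (1 + (z + y) ^ 2) * (1 + |z|) ^ s := by gcongr
    _ = _ := by ring

/-- Either `z` or `z + X` has size at least `|X| / 2`; the corresponding factor is bounded by a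
multiple of the inverse weight at `X`, and the other remains for integration. -/
theorem inv_one_add_sq_mul_weight_inv_le (X z : ℝ) :
    (1 + (z + X) ^ 2)⁻¹ * (weight s z)⁻¹
      ≤ 8 * (weight s X)⁻¹ * ((1 + (z + X) ^ 2)⁻¹ + (weight s z)⁻¹) := by
  have hX := weight_pos s X
  have hz := weight_pos s z
  have hq : 0 < (1 + (z + X) ^ 2)⁻¹ := by positivity
  have hr : 0 ≤ 2 - s := by linarith
  rcases le_total (|X| / 2) |z| with h | h
  · have h1 : weight s X ≤ 4 * weight s z := by
      have h2 : |X| ^ (2 - s) ≤ 4 * |z| ^ (2 - s) := by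
        calc |X| ^ (2 - s) ≤ (2 * |z|) ^ (2 - s) :=
              Real.rpow_le_rpow (abs_nonneg X) (by linarith) hr
          _ = 2 ^ (2 - s) * |z| ^ (2 - s) := Real.mul_rpow (by norm_num) (abs_nonneg z)
          _ ≤ 4 * |z| ^ (2 - s) := by
            gcongr
            have := Real.rpow_le_rpow_of_exponent_le one_le_two (show 2 - s ≤ 2 by linarith)
            rw [Real.rpow_two] at this
            linarith
      unfold weight
      linarith
    have h2 : (weight s z)⁻¹ ≤ 4 * (weight s X)⁻¹ := by
      rw [← div_eq_mul_inv, inv_eq_one_div, div_le_div_iff₀ hz hX]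
      linarith
    have : 0 < (weight s X)⁻¹ := inv_pos.2 hX
    have h3 : 0 < (weight s z)⁻¹ := inv_pos.2 hz
    nlinarith [mul_pos this h3, mul_pos this hq]
  · have h1 : (1 + (z + X) ^ 2)⁻¹ ≤ 8 * (weight s X)⁻¹ := by
      have := inv_one_add_sq_le_weight_inv hs0 hs1 X
      have h2 : |X| / 2 ≤ |z + X| := by
        have := abs_sub_abs_le_abs_add X z
        rw [add_comm X z] at this
        linarith
      linarith [inv_one_add_sq_le_of_half_le h2]
    have : 0 < (weight s X)⁻¹ := inv_pos.2 hX
    have h3 : 0 < (weight s z)⁻¹ := inv_pos.2 hz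
    nlinarith [mul_pos this hq]

theorem abs_rpow_neg_ge_weight_inv {X z d : ℝ} (hd : 0 < d) (hz : d ≤ |z|)
    (hz' : |z| ≤ |X| + d + 1) :
    (4 * (d + 1) ^ (2 - s))⁻¹ * (weight s X)⁻¹ ≤ (|z| ^ (2 - s))⁻¹ := by
  have hz0 : 0 < |z| := hd.trans_le hz
  rw [← mul_inv]
  refine inv_anti₀ (by positivity) ?_
  calc |z| ^ (2 - s) ≤ ((d + 1) * (1 + |X|)) ^ (2 - s) := by
        refine Real.rpow_le_rpow (abs_nonneg z) ?_ (by linarith)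
        nlinarith [abs_nonneg X]
    _ = (d + 1) ^ (2 - s) * (1 + |X|) ^ (2 - s) := Real.mul_rpow (by positivity) (by positivity)
    _ ≤ (d + 1) ^ (2 - s) * (4 * weight s X) := by
        gcongr
        exact one_add_abs_rpow_le_weight hs0 hs1 X
    _ = _ := by ring

/-- The prefactor of the operator cancels the singularity of the weight under `x ↦ t ^ 2 / x`, so
inverse weights go to inverse weights up to constants. -/
theorem abs_rpow_div_abs_rpow {t x : ℝ} (ht : 0 < t) (hx : x ≠ 0) :
    t ^ (2 - s) / |x| ^ (2 - s) * (weight s (t ^ 2 / x))⁻¹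
      = t ^ (2 - s) / (|x| ^ (2 - s) + (t ^ 2) ^ (2 - s)) := by
  have hx0 : 0 < |x| ^ (2 - s) := Real.rpow_pos_of_pos (abs_pos.2 hx) _
  have ht0 : 0 < (t ^ 2) ^ (2 - s) := by positivity
  unfold weight
  rw [abs_div, abs_of_pos (show 0 < t ^ 2 by positivity), Real.div_rpow (by positivity)
    (abs_nonneg x)]
  field_simp

theorem scaled_weight_inv_le {t x : ℝ} (ht : 0 < t) :
    t ^ (2 - s) / |x| ^ (2 - s) * (weight s (t ^ 2 / x))⁻¹
      ≤ (t ^ (2 - s) + t ^ (2 - s) / (t ^ 2) ^ (2 - s)) * (weight s x)⁻¹ := by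
  have hw := weight_pos s x
  -- At `x = 0` the prefactor is a division by zero, hence `0`, and the upper bound is trivial.
  rcases eq_or_ne x 0 with rfl | hx
  · rw [abs_zero, Real.zero_rpow (by linarith), div_zero, zero_mul]
    positivity
  rw [abs_rpow_div_abs_rpow hs0 hs1 ht hx]
  have hx0 : 0 < |x| ^ (2 - s) := Real.rpow_pos_of_pos (abs_pos.2 hx) _
  have ht0 : 0 < (t ^ 2) ^ (2 - s) := by positivity
  have ht1 : 0 < t ^ (2 - s) := by positivity
  rw [← div_eq_mul_inv, div_le_div_iff₀ (by positivity) hw]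
  unfold weight
  have h1 : t ^ (2 - s) / (t ^ 2) ^ (2 - s) * (t ^ 2) ^ (2 - s) = t ^ (2 - s) := by field_simp
  have h2 : 0 ≤ t ^ (2 - s) / (t ^ 2) ^ (2 - s) * |x| ^ (2 - s) := by positivity
  have h3 : 0 ≤ t ^ (2 - s) * (t ^ 2) ^ (2 - s) := by positivity
  linarith

theorem le_scaled_weight_inv {t x : ℝ} (ht : 0 < t) (hx : x ≠ 0) :
    t ^ (2 - s) / (1 + (t ^ 2) ^ (2 - s)) * (weight s x)⁻¹
      ≤ t ^ (2 - s) / |x| ^ (2 - s) * (weight s (t ^ 2 / x))⁻¹ := by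
  rw [abs_rpow_div_abs_rpow hs0 hs1 ht hx]
  have hx0 : 0 < |x| ^ (2 - s) := Real.rpow_pos_of_pos (abs_pos.2 hx) _
  have ht0 : 0 < (t ^ 2) ^ (2 - s) := by positivity
  have ht1 : 0 < t ^ (2 - s) := by positivity
  have hw := weight_pos s x
  rw [← div_eq_mul_inv, div_div, div_le_div_iff₀ (by positivity) (by positivity)]
  gcongr
  unfold weight
  nlinarith [mul_pos hx0 ht0]

end WeightEstimates

/-! ### Two-sided bounds for the first three powers of the transfer operator. -/

/-- The transfer operator with the kernel `p`, for functions with values in `[0, ∞]`. -/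
noncomputable def lintegralTransfer (p : ℝ → ℝ) (t s : ℝ) (u : ℝ → ℝ≥0∞) (x : ℝ) : ℝ≥0∞ :=
  ENNReal.ofReal (t ^ (2 - s) / |x| ^ (2 - s)) *
    ∫⁻ y, ENNReal.ofReal (p (-y - t ^ 2 / x)) * u y

theorem measurable_lintegralTransfer {p : ℝ → ℝ} (hp : Measurable p) (t s : ℝ) {u : ℝ → ℝ≥0∞}
    (hu : Measurable u) : Measurable (lintegralTransfer p t s u) := by
  unfold lintegralTransfer
  refine Measurable.mul (by fun_prop) ?_
  exact Measurable.lintegral_prod_right' (f := fun q : ℝ × ℝ =>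
    ENNReal.ofReal (p (-q.2 - t ^ 2 / q.1)) * u q.2) (by fun_prop)

theorem lintegralTransfer_mono {p : ℝ → ℝ} {t s : ℝ} {u v : ℝ → ℝ≥0∞} (huv : u ≤ᵐ[volume] v)
    (x : ℝ) : lintegralTransfer p t s u x ≤ lintegralTransfer p t s v x := by
  unfold lintegralTransfer
  refine mul_le_mul_right (lintegral_mono_ae ?_) _
  filter_upwards [huv] with y hy
  gcongr

theorem lintegralTransfer_const_mul {p : ℝ → ℝ} (hp : Measurable p) {t s : ℝ} {u : ℝ → ℝ≥0∞}
    (hu : Measurable u) (k : ℝ≥0∞) (x : ℝ) :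
    lintegralTransfer p t s (fun y => k * u y) x = k * lintegralTransfer p t s u x := by
  unfold lintegralTransfer
  have (y : ℝ) : ENNReal.ofReal (p (-y - t ^ 2 / x)) * (k * u y)
      = k * (ENNReal.ofReal (p (-y - t ^ 2 / x)) * u y) := by ring
  simp only [this]
  rw [lintegral_const_mul _ (by fun_prop)]
  ring

namespace IsCauchyComparable

variable {p : ℝ → ℝ} {c C : ℝ} (hp : IsCauchyComparable p c C)
include hp

theorem upper_pos : 0 < C := by
  have := (hp.lower 0).trans (hp.upper 0)
  have := hp.lower_pos
  norm_num at *
  linarith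

theorem pos (x : ℝ) : 0 < p x :=
  lt_of_lt_of_le (mul_pos hp.lower_pos (by positivity)) (hp.lower x)

theorem measurable : Measurable p := hp.continuous.measurable

theorem upper_neg_sub (z X : ℝ) : p (-z - X) ≤ C * (1 + (z + X) ^ 2)⁻¹ := by
  refine (hp.upper _).trans (le_of_eq ?_)
  ring_nf

theorem lower_of_abs_le {z X R : ℝ} (h : |z + X| ≤ R) : c * (1 + R ^ 2)⁻¹ ≤ p (-z - X) := by
  refine le_trans ?_ (hp.lower _)
  have h1 : (-z - X) ^ 2 ≤ R ^ 2 := by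
    have := pow_le_pow_left₀ (abs_nonneg _) h 2
    rw [sq_abs] at this
    linarith [show (-z - X) ^ 2 = (z + X) ^ 2 by ring]
  have := hp.lower_pos
  gcongr

variable {s : ℝ} (hs0 : 0 < s) (hs1 : s < 1)
include hs0 hs1

theorem exists_conv_weight_inv_le : ∃ A : ℝ, 0 < A ∧ ∀ X,
    ∫⁻ y, ENNReal.ofReal (p (-y - X)) * ENNReal.ofReal (weight s y)⁻¹
      ≤ ENNReal.ofReal A * ENNReal.ofReal (weight s X)⁻¹ := by
  have hC := hp.upper_pos
  have hI := integrable_weight_inv hs0 hs1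
  have hI0 : 0 ≤ ∫ y, (weight s y)⁻¹ := integral_nonneg fun y => (inv_pos.2 (weight_pos s y)).le
  have hpi := Real.pi_pos
  have hmw := measurable_weight s
  refine ⟨C * 8 * (Real.pi + ∫ y, (weight s y)⁻¹), by positivity, fun X => ?_⟩
  have hX := inv_pos.2 (weight_pos s X)
  have hq : Integrable fun y : ℝ => (1 + (y + X) ^ 2)⁻¹ := integrable_inv_one_add_sq.comp_add_right X
  calc ∫⁻ y, ENNReal.ofReal (p (-y - X)) * ENNReal.ofReal (weight s y)⁻¹
      ≤ ∫⁻ y, ENNReal.ofReal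
          (C * (8 * (weight s X)⁻¹) * ((1 + (y + X) ^ 2)⁻¹ + (weight s y)⁻¹)) := by
        refine lintegral_mono fun y => ?_
        have hy := inv_pos.2 (weight_pos s y)
        rw [← ENNReal.ofReal_mul (hp.pos _).le]
        refine ENNReal.ofReal_le_ofReal ?_
        calc p (-y - X) * (weight s y)⁻¹ ≤ C * (1 + (y + X) ^ 2)⁻¹ * (weight s y)⁻¹ := by
              gcongr
              exact hp.upper_neg_sub y X
          _ ≤ C * (8 * (weight s X)⁻¹ * ((1 + (y + X) ^ 2)⁻¹ + (weight s y)⁻¹)) := by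
              rw [mul_assoc]
              exact mul_le_mul_of_nonneg_left (inv_one_add_sq_mul_weight_inv_le hs0 hs1 X y) hC.le
          _ = _ := by ring
    _ = ENNReal.ofReal (∫ y,
          (C * (8 * (weight s X)⁻¹) * ((1 + (y + X) ^ 2)⁻¹ + (weight s y)⁻¹))) := by
        have hqI : Integrable fun y : ℝ => (1 + (y + X) ^ 2)⁻¹ + (weight s y)⁻¹ := hq.add hI
        rw [ofReal_integral_eq_lintegral_ofReal (hqI.const_mul _)]
        refine ae_of_all _ fun y => ?_
        have hy := inv_pos.2 (weight_pos s y)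
        positivity
    _ = ENNReal.ofReal (C * 8 * (Real.pi + ∫ y, (weight s y)⁻¹) * (weight s X)⁻¹) := by
        rw [integral_const_mul, integral_add hq hI,
          integral_add_right_eq_self (fun y : ℝ => (1 + y ^ 2)⁻¹), integral_univ_inv_one_add_sq]
        congr 1
        ring
    _ = _ := ENNReal.ofReal_mul (by positivity)

theorem exists_transfer_weight_inv_le {t : ℝ} (ht : 0 < t) : ∃ A : ℝ, 0 < A ∧ ∀ x,
    lintegralTransfer p t s (fun y => ENNReal.ofReal (weight s y)⁻¹) x
      ≤ ENNReal.ofReal A * ENNReal.ofReal (weight s x)⁻¹ := by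
  obtain ⟨A, hA, hAX⟩ := hp.exists_conv_weight_inv_le hs0 hs1
  refine ⟨A * (t ^ (2 - s) + t ^ (2 - s) / (t ^ 2) ^ (2 - s)), by positivity, fun x => ?_⟩
  unfold lintegralTransfer
  refine (mul_le_mul_right (hAX _) _).trans ?_
  have hx := inv_pos.2 (weight_pos s x)
  rw [← ENNReal.ofReal_mul (by positivity), ← ENNReal.ofReal_mul (by positivity),
    ← ENNReal.ofReal_mul (by positivity)]
  refine ENNReal.ofReal_le_ofReal ?_
  have := mul_le_mul_of_nonneg_left (scaled_weight_inv_le hs0 hs1 ht (x := x)) hA.le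
  linarith

/-- The total mass that the transfer operator sends from `y` to the interval `(-1, 1)`. -/
theorem lintegral_kernel_near_zero {t : ℝ} (ht : 0 < t) (y : ℝ) :
    ∫⁻ z, Set.indicator {z | |z| < 1} (fun z => ENNReal.ofReal (t ^ (2 - s) / |z| ^ (2 - s)) *
        ENNReal.ofReal (p (-y - t ^ 2 / z))) z
      = ∫⁻ z, Set.indicator {z | t ^ 2 < |z|} (fun z => ENNReal.ofReal (t ^ s * |z| ^ (-s)) *
        ENNReal.ofReal (p (-z - y))) z := by
  rw [lintegral_comp_const_div (show t ^ 2 ≠ 0 by positivity)]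
  have h0 : ∀ᵐ z : ℝ, z ≠ 0 := by simp [ae_iff]
  refine lintegral_congr_ae ?_
  filter_upwards [h0] with z hz
  have hz' : 0 < |z| := abs_pos.2 hz
  have hmem : t ^ 2 / z ∈ {z : ℝ | |z| < 1} ↔ z ∈ {z : ℝ | t ^ 2 < |z|} := by
    simp only [Set.mem_ofPred_eq]
    rw [abs_div, abs_of_pos (show 0 < t ^ 2 by positivity), div_lt_one hz']
  by_cases hzm : z ∈ {z : ℝ | t ^ 2 < |z|}
  · rw [Set.indicator_of_mem hzm, Set.indicator_of_mem (hmem.2 hzm), ← mul_assoc,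
      ← ENNReal.ofReal_mul (by positivity)]
    congr 2
    -- The Jacobian `t ^ 2 / z ^ 2` times the prefactor at `t ^ 2 / z` equals `t ^ s * |z| ^ (-s)`.
    · rw [abs_div, abs_of_pos (show 0 < t ^ 2 by positivity), Real.div_rpow (by positivity)
        (abs_nonneg z), Real.rpow_neg hz'.le, Real.rpow_sub hz', Real.rpow_two,
        Real.rpow_sub ht, Real.rpow_sub (show 0 < t ^ 2 by positivity), Real.rpow_two, Real.rpow_two,
        ← Real.rpow_natCast t 2, ← Real.rpow_mul ht.le, mul_comm ((2 : ℕ) : ℝ) s, Real.rpow_mul ht.le,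
        Real.rpow_natCast, Real.rpow_natCast, sq_abs]
      have : 0 < t ^ s := by positivity
      have : 0 < |z| ^ s := by positivity
      field_simp
    · congr 1
      field_simp
      ring
  · rw [Set.indicator_of_notMem hzm, Set.indicator_of_notMem (fun h => hzm (hmem.1 h)), mul_zero]

/-- After inversion this is `|z| ^ (-s)`, cut off near zero, averaged against a density concentrated
around `-y`. This is where the functional with weight `decay` comes from. -/
theorem exists_lintegral_kernel_near_zero_le {t : ℝ} (ht : 0 < t) : ∃ A : ℝ, 0 < A ∧ ∀ y,
    ∫⁻ z, Set.indicator {z | |z| < 1} (fun z => ENNReal.ofReal (t ^ (2 - s) / |z| ^ (2 - s)) *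
        ENNReal.ofReal (p (-y - t ^ 2 / z))) z ≤ ENNReal.ofReal A * ENNReal.ofReal (decay s y) := by
  have hC := hp.upper_pos
  have hI : Integrable fun x : ℝ => (1 + |x|) ^ (-(2 - s)) :=
    integrable_one_add_norm (by rw [Module.finrank_self]; push_cast; linarith)
  have hI0 : 0 ≤ ∫ x : ℝ, (1 + |x|) ^ (-(2 - s)) := integral_nonneg fun x => by positivity
  refine ⟨t ^ s * (1 + (t ^ 2)⁻¹) ^ s * C * 2 * (1 + ∫ x : ℝ, (1 + |x|) ^ (-(2 - s))),
    by positivity, fun y => ?_⟩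
  have hy := decay_pos s y
  rw [hp.lintegral_kernel_near_zero hs0 hs1 ht]
  calc _ ≤ ∫⁻ z, ENNReal.ofReal (t ^ s * (1 + (t ^ 2)⁻¹) ^ s * C * 2 * decay s y *
        (1 + |z + y|) ^ (-(2 - s))) := by
        refine lintegral_mono fun z => ?_
        refine Set.indicator_apply_le' (fun hz => ?_) fun _ => zero_le
        simp only [Set.mem_ofPred_eq] at hz
        have hz0 : 0 < |z| := lt_trans (by positivity) hz
        rw [← ENNReal.ofReal_mul (by positivity)]
        refine ENNReal.ofReal_le_ofReal ?_
        have h1 : |z| ^ (-s) ≤ (1 + (t ^ 2)⁻¹) ^ s * decay s z := by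
          unfold decay
          rw [Real.rpow_neg hz0.le, Real.rpow_neg (by positivity), ← div_eq_mul_inv, inv_eq_one_div,
            div_le_div_iff₀ (by positivity) (by positivity), one_mul,
            ← Real.mul_rpow (by positivity) (by positivity)]
          refine Real.rpow_le_rpow (by positivity) ?_ hs0.le
          have : 1 ≤ (t ^ 2)⁻¹ * |z| := by
            rw [inv_mul_eq_div, one_le_div (by positivity)]; exact hz.le
          linarith
        have hd := decay_pos s z
        calc t ^ s * |z| ^ (-s) * p (-z - y)
            ≤ t ^ s * ((1 + (t ^ 2)⁻¹) ^ s * decay s z) * (C * (1 + (z + y) ^ 2)⁻¹) := by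
              have := hp.upper_neg_sub z y
              have := (hp.pos (-z - y)).le
              gcongr
          _ = t ^ s * (1 + (t ^ 2)⁻¹) ^ s * C * ((1 + (z + y) ^ 2)⁻¹ * decay s z) := by ring
          _ ≤ t ^ s * (1 + (t ^ 2)⁻¹) ^ s * C *
                (2 * (1 + |z + y|) ^ (-(2 - s)) * decay s y) := by
              gcongr ?_ * ?_
              exact inv_one_add_sq_mul_decay_le hs0 hs1 y z
          _ = _ := by ring
    _ = ENNReal.ofReal (t ^ s * (1 + (t ^ 2)⁻¹) ^ s * C * 2 * decay s y *
          ∫ x : ℝ, (1 + |x|) ^ (-(2 - s))) := by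
        rw [← ofReal_integral_eq_lintegral_ofReal ((hI.comp_add_right y).const_mul _)
          (ae_of_all _ fun z => by positivity), integral_const_mul,
          integral_add_right_eq_self (fun x : ℝ => (1 + |x|) ^ (-(2 - s)))]
    _ ≤ _ := by
        rw [← ENNReal.ofReal_mul (by positivity)]
        refine ENNReal.ofReal_le_ofReal ?_
        have : 0 ≤ t ^ s * (1 + (t ^ 2)⁻¹) ^ s * C * 2 * decay s y := by positivity
        linarith

theorem exists_le_lintegral_kernel_near_zero {t : ℝ} (ht : 0 < t) : ∃ A : ℝ, 0 < A ∧ ∀ y,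
    ENNReal.ofReal A * ENNReal.ofReal (decay s y) ≤
    ∫⁻ z, Set.indicator {z | |z| < 1} (fun z => ENNReal.ofReal (t ^ (2 - s) / |z| ^ (2 - s)) *
        ENNReal.ofReal (p (-y - t ^ 2 / z))) z := by
  have hc := hp.lower_pos
  refine ⟨t ^ s * (t ^ 2 + 2) ^ (-s) * (c * (1 + (t ^ 2 + 1 + 1) ^ 2)⁻¹), by positivity,
    fun y => ?_⟩
  rw [hp.lintegral_kernel_near_zero hs0 hs1 ht]
  -- The extra `1` gives the strict inequality `t ^ 2 < |z|` that defines the region of integration.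
  refine le_lintegral_of_window y (t ^ 2 + 1) (fun z hz1 hz2 hz3 _ => ?_) (by positivity)
  have hz : t ^ 2 < |z| := by linarith
  have hz0 : 0 < |z| := lt_trans (by positivity) hz
  rw [Set.indicator_of_mem (show z ∈ {z : ℝ | t ^ 2 < |z|} from hz),
    ← ENNReal.ofReal_mul (by positivity), ← ENNReal.ofReal_mul (by positivity)]
  refine ENNReal.ofReal_le_ofReal ?_
  have h1 : (t ^ 2 + 2) ^ (-s) * decay s y ≤ |z| ^ (-s) := by
    unfold decay
    rw [← Real.mul_rpow (by positivity) (by positivity)]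
    refine Real.rpow_le_rpow_of_nonpos hz0 ?_ (by linarith)
    nlinarith [abs_nonneg y, mul_nonneg (sq_nonneg t) (abs_nonneg y)]
  have h2 := hp.lower_of_abs_le hz3
  have := (hp.pos (-z - y)).le
  have hy := decay_pos s y
  calc _ = t ^ s * ((t ^ 2 + 2) ^ (-s) * decay s y) * (c * (1 + (t ^ 2 + 1 + 1) ^ 2)⁻¹) := by ring
    _ ≤ _ := by gcongr

theorem setLIntegral_transfer {t : ℝ} {u : ℝ → ℝ≥0∞} (hu : Measurable u) :
    ∫⁻ z, Set.indicator {z | |z| < 1} (lintegralTransfer p t s u) z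
      = ∫⁻ y, (∫⁻ z, Set.indicator {z | |z| < 1} (fun z =>
          ENNReal.ofReal (t ^ (2 - s) / |z| ^ (2 - s)) *
          ENNReal.ofReal (p (-y - t ^ 2 / z))) z) * u y := by
  have hS : MeasurableSet {z : ℝ | |z| < 1} := measurableSet_lt (by fun_prop) (by fun_prop)
  have hm := hp.measurable
  simp only [lintegral_indicator hS]
  have h1 (y : ℝ) : (∫⁻ z in {z : ℝ | |z| < 1}, ENNReal.ofReal (t ^ (2 - s) / |z| ^ (2 - s)) *
          ENNReal.ofReal (p (-y - t ^ 2 / z))) * u y =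
      ∫⁻ z in {z : ℝ | |z| < 1}, ENNReal.ofReal (t ^ (2 - s) / |z| ^ (2 - s)) *
          ENNReal.ofReal (p (-y - t ^ 2 / z)) * u y := by
    rw [lintegral_mul_const _ (by fun_prop)]
  simp only [h1]
  rw [lintegral_lintegral_swap (by fun_prop)]
  refine lintegral_congr fun z => ?_
  unfold lintegralTransfer
  simp only [mul_assoc]
  rw [lintegral_const_mul _ (by fun_prop)]

end IsCauchyComparable

namespace IsCauchyComparable

variable {p : ℝ → ℝ} {c C : ℝ} (hp : IsCauchyComparable p c C)
  {s : ℝ} (hs0 : 0 < s) (hs1 : s < 1) {t : ℝ} (ht : 0 < t)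
include hp hs0 hs1 ht

/-- For such `z` the shift `t ^ 2 / z` is bounded, so Peetre's inequality removes it from the
kernel. Near zero the image is controlled only in the mean. -/
theorem exists_transfer_le_of_one_le_abs : ∃ A : ℝ, 0 < A ∧ ∀ u : ℝ → ℝ≥0∞, Measurable u →
    ∀ z, 1 ≤ |z| → lintegralTransfer p t s u z ≤
      ENNReal.ofReal A * ENNReal.ofReal (weight s z)⁻¹ *
        ∫⁻ y, ENNReal.ofReal (decay s y) * u y := by
  have hC := hp.upper_pos
  have hdm : Measurable (decay s) := (continuous_decay s).measurable
  refine ⟨2 * t ^ (2 - s) * (C * (4 * (1 + t ^ 4))), by positivity, fun u hu z hz => ?_⟩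
  unfold lintegralTransfer
  have hz0 : 0 < |z| := by linarith
  have hw := weight_pos s z
  have h1 : t ^ (2 - s) / |z| ^ (2 - s) ≤ 2 * t ^ (2 - s) * (weight s z)⁻¹ := by
    have : 1 ≤ |z| ^ (2 - s) := Real.one_le_rpow hz (by linarith)
    rw [← div_eq_mul_inv, div_le_div_iff₀ (by positivity) hw]
    have h3 : weight s z ≤ 2 * |z| ^ (2 - s) := by unfold weight; linarith
    have := mul_le_mul_of_nonneg_left h3 (show 0 ≤ t ^ (2 - s) by positivity)
    linarith
  have h2 : ∫⁻ y, ENNReal.ofReal (p (-y - t ^ 2 / z)) * u y ≤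
      ENNReal.ofReal (C * (4 * (1 + t ^ 4))) * ∫⁻ y, ENNReal.ofReal (decay s y) * u y := by
    rw [← lintegral_const_mul _ (by fun_prop)]
    refine lintegral_mono fun y => ?_
    rw [← mul_assoc, ← ENNReal.ofReal_mul (by positivity)]
    gcongr
    have h3 : (t ^ 2 / z) ^ 2 ≤ t ^ 4 := by
      rw [div_pow, ← pow_mul, ← sq_abs z]
      exact div_le_self (by positivity) (one_le_pow₀ hz)
    calc p (-y - t ^ 2 / z) ≤ C * (1 + (y + t ^ 2 / z) ^ 2)⁻¹ := hp.upper_neg_sub _ _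
      _ ≤ C * (2 * (1 + (t ^ 2 / z) ^ 2) * (1 + y ^ 2)⁻¹) :=
          mul_le_mul_of_nonneg_left (inv_one_add_sq_add_le _ _) hC.le
      _ ≤ C * (2 * (1 + t ^ 4) * (2 * decay s y)) := by
          gcongr
          exact inv_one_add_sq_le_decay hs0 hs1 y
      _ = _ := by ring
  calc _ ≤ ENNReal.ofReal (2 * t ^ (2 - s) * (weight s z)⁻¹) *
        (ENNReal.ofReal (C * (4 * (1 + t ^ 4))) * ∫⁻ y, ENNReal.ofReal (decay s y) * u y) := by
        gcongr
    _ = _ := by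
        rw [ENNReal.ofReal_mul (by positivity : 0 ≤ 2 * t ^ (2 - s)),
          ENNReal.ofReal_mul (by positivity : 0 ≤ 2 * t ^ (2 - s))]
        ring

theorem exists_lintegral_transfer_near_zero_bounds : ∃ A B : ℝ, 0 < A ∧ 0 < B ∧
    ∀ u : ℝ → ℝ≥0∞, Measurable u →
      ENNReal.ofReal A * ∫⁻ y, ENNReal.ofReal (decay s y) * u y ≤
        ∫⁻ z, Set.indicator {z | |z| < 1} (lintegralTransfer p t s u) z ∧
      ∫⁻ z, Set.indicator {z | |z| < 1} (lintegralTransfer p t s u) z ≤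
        ENNReal.ofReal B * ∫⁻ y, ENNReal.ofReal (decay s y) * u y := by
  obtain ⟨A, hA, hAy⟩ := hp.exists_le_lintegral_kernel_near_zero hs0 hs1 ht
  obtain ⟨B, hB, hBy⟩ := hp.exists_lintegral_kernel_near_zero_le hs0 hs1 ht
  have hdm : Measurable (decay s) := (continuous_decay s).measurable
  refine ⟨A, B, hA, hB, fun u hu => ?_⟩
  rw [hp.setLIntegral_transfer hs0 hs1 hu, ← lintegral_const_mul _ (by fun_prop),
    ← lintegral_const_mul _ (by fun_prop)]
  constructor
  · refine lintegral_mono fun y => ?_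
    rw [← mul_assoc]
    exact mul_le_mul_left (hAy y) _
  · refine lintegral_mono fun y => ?_
    rw [← mul_assoc]
    exact mul_le_mul_left (hBy y) _

/-- For `|z| ≥ 1` the pointwise bound on the image is used. For `|z| < 1` the kernel is bounded
uniformly in `z` by a multiple of the inverse weight at `X`, so the integral of the image over `(-1,
1)` suffices. -/
theorem exists_conv_transfer_le : ∃ A : ℝ, 0 < A ∧ ∀ u : ℝ → ℝ≥0∞, Measurable u → ∀ X,
    ∫⁻ z, ENNReal.ofReal (p (-z - X)) * lintegralTransfer p t s u z ≤
      ENNReal.ofReal A * ENNReal.ofReal (weight s X)⁻¹ *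
        ∫⁻ y, ENNReal.ofReal (decay s y) * u y := by
  have hC := hp.upper_pos
  have hm := hp.measurable
  have hmw := measurable_weight s
  obtain ⟨A₁, hA₁, h1⟩ := hp.exists_transfer_le_of_one_le_abs hs0 hs1 ht
  obtain ⟨A₂, hA₂, h2⟩ := hp.exists_conv_weight_inv_le hs0 hs1
  obtain ⟨_, B, _, hB, h3⟩ := hp.exists_lintegral_transfer_near_zero_bounds hs0 hs1 ht
  refine ⟨A₁ * A₂ + 16 * C * B, by positivity, fun u hu X => ?_⟩
  set I := ∫⁻ y, ENNReal.ofReal (decay s y) * u y with hI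
  have hX := inv_pos.2 (weight_pos s X)
  have hTm := measurable_lintegralTransfer hm t s hu
  have hS : MeasurableSet {z : ℝ | |z| < 1} := measurableSet_lt (by fun_prop) (by fun_prop)
  have hpt (z : ℝ) : ENNReal.ofReal (p (-z - X)) * lintegralTransfer p t s u z ≤
      (ENNReal.ofReal A₁ * I) * (ENNReal.ofReal (p (-z - X)) * ENNReal.ofReal (weight s z)⁻¹) +
      ENNReal.ofReal (16 * C * (weight s X)⁻¹) *
        Set.indicator {z | |z| < 1} (lintegralTransfer p t s u) z := by
    by_cases hz : |z| < 1
    · refine le_add_left ?_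
      rw [Set.indicator_of_mem (show z ∈ {z : ℝ | |z| < 1} from hz)]
      gcongr
      have hz2 : z ^ 2 ≤ 1 := (sq_le_one_iff_abs_le_one z).2 hz.le
      have hq : 0 ≤ (1 + X ^ 2)⁻¹ := by positivity
      calc p (-z - X) ≤ C * (1 + (z + X) ^ 2)⁻¹ := hp.upper_neg_sub _ _
        _ ≤ C * (2 * (1 + z ^ 2) * (1 + X ^ 2)⁻¹) := by
            rw [add_comm z X]
            exact mul_le_mul_of_nonneg_left (inv_one_add_sq_add_le _ _) hC.le
        _ ≤ C * (2 * (1 + 1) * (1 + X ^ 2)⁻¹) := by gcongr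
        _ ≤ C * (2 * (1 + 1) * (2 * (weight s X)⁻¹)) := by
            gcongr
            exact inv_one_add_sq_le_weight_inv hs0 hs1 X
        _ ≤ _ := by nlinarith [mul_pos hC hX]
    · refine le_add_right ?_
      calc _ ≤ ENNReal.ofReal (p (-z - X)) *
            (ENNReal.ofReal A₁ * ENNReal.ofReal (weight s z)⁻¹ * I) := by
            gcongr
            exact h1 u hu z (not_lt.1 hz)
        _ = _ := by ring
  calc _ ≤ _ := lintegral_mono hpt
    _ = (ENNReal.ofReal A₁ * I) * (∫⁻ z, ENNReal.ofReal (p (-z - X)) *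
          ENNReal.ofReal (weight s z)⁻¹) +
        ENNReal.ofReal (16 * C * (weight s X)⁻¹) *
          ∫⁻ z, Set.indicator {z | |z| < 1} (lintegralTransfer p t s u) z := by
        rw [lintegral_add_left (by fun_prop), lintegral_const_mul _ (by fun_prop),
          lintegral_const_mul _ (hTm.indicator hS)]
    _ ≤ (ENNReal.ofReal A₁ * I) * (ENNReal.ofReal A₂ * ENNReal.ofReal (weight s X)⁻¹) +
        ENNReal.ofReal (16 * C * (weight s X)⁻¹) * (ENNReal.ofReal B * I) := by
        gcongr
        · exact h2 X
        · exact (h3 u hu).2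
    _ = _ := by
        have h16 : 0 ≤ 16 * C := by positivity
        rw [ENNReal.ofReal_add (by positivity) (by positivity), ENNReal.ofReal_mul hA₁.le,
          ENNReal.ofReal_mul h16, ENNReal.ofReal_mul h16]
        ring

theorem exists_transfer_sq_le : ∃ A : ℝ, 0 < A ∧ ∀ u : ℝ → ℝ≥0∞, Measurable u → ∀ x,
    lintegralTransfer p t s (lintegralTransfer p t s u) x ≤
      ENNReal.ofReal A * (∫⁻ y, ENNReal.ofReal (decay s y) * u y) *
        ENNReal.ofReal (weight s x)⁻¹ := by
  obtain ⟨A, hA, h1⟩ := hp.exists_conv_transfer_le hs0 hs1 ht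
  refine ⟨A * (t ^ (2 - s) + t ^ (2 - s) / (t ^ 2) ^ (2 - s)), by positivity, fun u hu x => ?_⟩
  set I := ∫⁻ y, ENNReal.ofReal (decay s y) * u y with hI
  have hw := inv_pos.2 (weight_pos s (t ^ 2 / x))
  calc lintegralTransfer p t s (lintegralTransfer p t s u) x
      ≤ ENNReal.ofReal (t ^ (2 - s) / |x| ^ (2 - s)) *
          (ENNReal.ofReal A * ENNReal.ofReal (weight s (t ^ 2 / x))⁻¹ * I) := by
        unfold lintegralTransfer
        gcongr
        exact h1 u hu _
    _ = ENNReal.ofReal A * I *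
          ENNReal.ofReal (t ^ (2 - s) / |x| ^ (2 - s) * (weight s (t ^ 2 / x))⁻¹) := by
        rw [ENNReal.ofReal_mul (by positivity)]
        ring
    _ ≤ ENNReal.ofReal A * I * ENNReal.ofReal
          ((t ^ (2 - s) + t ^ (2 - s) / (t ^ 2) ^ (2 - s)) * (weight s x)⁻¹) :=
        mul_le_mul_right (ENNReal.ofReal_le_ofReal (scaled_weight_inv_le hs0 hs1 ht)) _
    _ = _ := by
        rw [ENNReal.ofReal_mul (by positivity), ENNReal.ofReal_mul hA.le]
        ring

/-- The square already satisfies such a bound; the third factor only matches the power needed from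
below. -/
theorem exists_transfer_cube_le : ∃ A : ℝ, 0 < A ∧ ∀ u : ℝ → ℝ≥0∞, Measurable u → ∀ x,
    lintegralTransfer p t s (lintegralTransfer p t s (lintegralTransfer p t s u)) x ≤
      ENNReal.ofReal A * (∫⁻ y, ENNReal.ofReal (decay s y) * u y) *
        ENNReal.ofReal (weight s x)⁻¹ := by
  obtain ⟨A, hA, h1⟩ := hp.exists_transfer_sq_le hs0 hs1 ht
  obtain ⟨B, hB, h2⟩ := hp.exists_transfer_weight_inv_le hs0 hs1 ht
  have hmw := measurable_weight s
  refine ⟨A * B, by positivity, fun u hu x => ?_⟩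
  refine (lintegralTransfer_mono (ae_of_all _ (h1 u hu)) x).trans ?_
  rw [lintegralTransfer_const_mul hp.measurable (by fun_prop)]
  refine (mul_le_mul_right (h2 x) _).trans (le_of_eq ?_)
  rw [ENNReal.ofReal_mul hA.le]
  ring

/-- For `|x| ≥ t ^ 2` the shift is at most `1`, so the kernel is bounded below on all of `(-1, 1)`,
where the first image has integral comparable to the functional. -/
theorem exists_le_transfer_sq : ∃ A : ℝ, 0 < A ∧ ∀ u : ℝ → ℝ≥0∞, Measurable u → ∀ x,
    t ^ 2 ≤ |x| → ENNReal.ofReal A * (∫⁻ y, ENNReal.ofReal (decay s y) * u y) *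
        ENNReal.ofReal (|x| ^ (2 - s))⁻¹ ≤
      lintegralTransfer p t s (lintegralTransfer p t s u) x := by
  obtain ⟨A, _, hA, _, h1⟩ := hp.exists_lintegral_transfer_near_zero_bounds hs0 hs1 ht
  have hc := hp.lower_pos
  refine ⟨t ^ (2 - s) * (c * (1 + 2 ^ 2)⁻¹) * A, by positivity, fun u hu x hx => ?_⟩
  have hS : MeasurableSet {z : ℝ | |z| < 1} := measurableSet_lt (by fun_prop) (by fun_prop)
  have hTm := measurable_lintegralTransfer hp.measurable t s hu
  have hx0 : 0 < |x| := lt_of_lt_of_le (by positivity) hx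
  have h2 : ENNReal.ofReal (c * (1 + 2 ^ 2)⁻¹) *
      ∫⁻ z, Set.indicator {z | |z| < 1} (lintegralTransfer p t s u) z ≤
      ∫⁻ z, ENNReal.ofReal (p (-z - t ^ 2 / x)) * lintegralTransfer p t s u z := by
    rw [← lintegral_const_mul _ (hTm.indicator hS)]
    refine lintegral_mono fun z => ?_
    by_cases hz : |z| < 1
    · rw [Set.indicator_of_mem (show z ∈ {z : ℝ | |z| < 1} from hz)]
      gcongr
      refine hp.lower_of_abs_le ?_
      have : |t ^ 2 / x| ≤ 1 := by
        rw [abs_div, abs_of_pos (by positivity), div_le_one hx0]; exact hx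
      linarith [abs_add_le z (t ^ 2 / x)]
    · rw [Set.indicator_of_notMem (show z ∉ {z : ℝ | |z| < 1} from hz), mul_zero]
      exact zero_le
  rw [lintegralTransfer]
  refine le_trans (le_of_eq ?_) (mul_le_mul_right
    ((mul_le_mul_right (h1 u hu).1 (ENNReal.ofReal (c * (1 + 2 ^ 2)⁻¹))).trans h2) _)
  rw [div_eq_mul_inv, ENNReal.ofReal_mul (by positivity),
    ENNReal.ofReal_mul (p := t ^ (2 - s)) (by positivity),
    ENNReal.ofReal_mul (p := t ^ (2 - s)) (by positivity)]
  ring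

/-- The third application removes the restriction on `x`: integrate over a unit window close to `-t
^ 2 / x` but outside `(-t ^ 2, t ^ 2)`, where the lower bound for the square is available. -/
theorem exists_le_transfer_cube : ∃ A : ℝ, 0 < A ∧ ∀ u : ℝ → ℝ≥0∞, Measurable u → ∀ x,
    x ≠ 0 → ENNReal.ofReal A * (∫⁻ y, ENNReal.ofReal (decay s y) * u y) *
        ENNReal.ofReal (weight s x)⁻¹ ≤
      lintegralTransfer p t s (lintegralTransfer p t s (lintegralTransfer p t s u)) x := by
  obtain ⟨A, hA, h1⟩ := hp.exists_le_transfer_sq hs0 hs1 ht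
  have hc := hp.lower_pos
  have ht2 : 0 < t ^ 2 := by positivity
  set D : ℝ := c * (1 + (t ^ 2 + 1) ^ 2)⁻¹ * (4 * (t ^ 2 + 1) ^ (2 - s))⁻¹ with hD
  have hD0 : 0 < D := by positivity
  refine ⟨A * D * (t ^ (2 - s) / (1 + (t ^ 2) ^ (2 - s))), by positivity, fun u hu x hx => ?_⟩
  set I := ∫⁻ y, ENNReal.ofReal (decay s y) * u y with hI
  have hwx := inv_pos.2 (weight_pos s x)
  have hwX := inv_pos.2 (weight_pos s (t ^ 2 / x))
  have h2 : ENNReal.ofReal (D * (weight s (t ^ 2 / x))⁻¹) * (ENNReal.ofReal A * I) ≤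
      ∫⁻ z, ENNReal.ofReal (p (-z - t ^ 2 / x)) *
        lintegralTransfer p t s (lintegralTransfer p t s u) z := by
    refine le_lintegral_of_window (t ^ 2 / x) (t ^ 2) (fun z hz1 hz2 hz3 _ => ?_) ht2.le
    refine le_trans ?_ (mul_le_mul_right (h1 u hu z hz1) _)
    have hr := abs_rpow_neg_ge_weight_inv hs0 hs1 ht2 hz1 hz2
    calc _ ≤ ENNReal.ofReal (p (-z - t ^ 2 / x) * (|z| ^ (2 - s))⁻¹) * (ENNReal.ofReal A * I) := by
          refine mul_le_mul_left (ENNReal.ofReal_le_ofReal ?_) _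
          rw [hD, mul_assoc]
          refine mul_le_mul (hp.lower_of_abs_le hz3) hr (by positivity) (hp.pos _).le
      _ = _ := by
          rw [ENNReal.ofReal_mul (hp.pos _).le]
          ring
  have h3 := le_scaled_weight_inv hs0 hs1 ht hx
  clear_value D
  calc _ = ENNReal.ofReal (t ^ (2 - s) / (1 + (t ^ 2) ^ (2 - s)) * (weight s x)⁻¹) *
        (ENNReal.ofReal D * (ENNReal.ofReal A * I)) := by
        rw [ENNReal.ofReal_mul (mul_pos hA hD0).le, ENNReal.ofReal_mul hA.le,
          ENNReal.ofReal_mul (p := t ^ (2 - s) / (1 + (t ^ 2) ^ (2 - s))) (by positivity)]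
        ring
    _ ≤ ENNReal.ofReal (t ^ (2 - s) / |x| ^ (2 - s) * (weight s (t ^ 2 / x))⁻¹) *
        (ENNReal.ofReal D * (ENNReal.ofReal A * I)) := by gcongr
    _ = ENNReal.ofReal (t ^ (2 - s) / |x| ^ (2 - s)) *
        (ENNReal.ofReal (D * (weight s (t ^ 2 / x))⁻¹) * (ENNReal.ofReal A * I)) := by
        rw [ENNReal.ofReal_mul (by positivity), ENNReal.ofReal_mul hD0.le]
        ring
    _ ≤ _ := by
        rw [lintegralTransfer]
        exact mul_le_mul_right h2 _

end IsCauchyComparable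

/-! ### The weighted space as an order unit Banach space. -/

namespace WeightedLInfty

variable {s : ℝ}

theorem measurable_coe (f : WeightedLInfty s) : Measurable (f : ℝ → ℝ) := f.1.measurable

theorem ext_ae {f g : WeightedLInfty s} (h : ∀ᵐ x : ℝ, f x = g x) : f = g :=
  Subtype.ext (AEEqFun.ext h)

theorem coe_add (f g : WeightedLInfty s) : ∀ᵐ x : ℝ, (f + g) x = f x + g x :=
  AEEqFun.coeFn_add f.1 g.1

theorem coe_smul (k : ℝ) (f : WeightedLInfty s) : ∀ᵐ x : ℝ, (k • f) x = k * f x :=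
  AEEqFun.coeFn_smul k f.1

theorem coe_zero : ∀ᵐ x : ℝ, (0 : WeightedLInfty s) x = 0 :=
  AEEqFun.coeFn_zero (α := ℝ) (β := ℝ) (μ := volume)

theorem norm_le_iff (f : WeightedLInfty s) {C : ℝ} (hC : 0 ≤ C) :
    ‖f‖ ≤ C ↔ ∀ᵐ x : ℝ, |f x| ≤ C * (weight s x)⁻¹ := by
  have hf : MemLp (fun x => f x * weight s x) ∞ volume := f.2
  have hpt (x : ℝ) : ‖f x * weight s x‖ₑ ≤ ENNReal.ofReal C ↔ |f x| ≤ C * (weight s x)⁻¹ := by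
    have hw := weight_pos s x
    rw [← ofReal_norm, ENNReal.ofReal_le_ofReal_iff hC, norm_mul, Real.norm_eq_abs,
      Real.norm_of_nonneg hw.le, ← div_eq_mul_inv, le_div_iff₀ hw]
  rw [norm_eq, ← ENNReal.le_ofReal_iff_toReal_le hf.2.ne hC, eLpNorm_exponent_top]
  constructor
  · intro h
    filter_upwards [ae_le_eLpNormEssSup (f := fun x => f x * weight s x) (μ := volume)] with x hx
    exact (hpt x).1 (hx.trans h)
  · intro h
    refine essSup_le_of_ae_le _ ?_
    filter_upwards [h] with x hx
    exact (hpt x).2 hx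

theorem abs_le_norm (f : WeightedLInfty s) : ∀ᵐ x : ℝ, |f x| ≤ ‖f‖ * (weight s x)⁻¹ :=
  (norm_le_iff f (norm_nonneg f)).1 le_rfl

theorem exists_of_bound {f : ℝ → ℝ} (hf : Measurable f) {C : ℝ}
    (hC : ∀ᵐ x : ℝ, |f x| ≤ C * (weight s x)⁻¹) :
    ∃ g : WeightedLInfty s, ∀ᵐ x : ℝ, g x = f x := by
  have hcoe := AEEqFun.coeFn_mk f hf.aestronglyMeasurable (μ := volume)
  refine ⟨⟨AEEqFun.mk f hf.aestronglyMeasurable, ?_⟩, hcoe⟩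
  change MemLp _ _ _
  have h1 : MemLp (fun x => f x * weight s x) ∞ volume := by
    refine memLp_top_of_bound (hf.mul (measurable_weight s)).aestronglyMeasurable C ?_
    filter_upwards [hC] with x hx
    have hw := weight_pos s x
    rw [norm_mul, Real.norm_eq_abs, Real.norm_of_nonneg hw.le, ← le_div_iff₀ hw, div_eq_mul_inv]
    exact hx
  refine (memLp_congr_ae ?_).2 h1
  filter_upwards [hcoe] with x hx
  rw [hx]

instance : CompleteSpace (WeightedLInfty s) := by
  have hiso : Isometry (mulWeight s) :=
    AddMonoidHomClass.isometry_of_norm (mulWeight s) fun f => rfl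
  -- Multiplication by the weight is also onto: divide an essentially bounded function by the
  -- weight.
  refine (hiso.isUniformInducing.completeSpace_congr fun g => ?_).2 inferInstance
  have hmw := measurable_weight s
  have hg : Measurable (g : ℝ → ℝ) := (Lp.stronglyMeasurable g).measurable
  have hgb : ∀ᵐ x : ℝ, ‖g x‖ ≤ ‖g‖ := by
    filter_upwards [ae_le_eLpNormEssSup (f := (g : ℝ → ℝ)) (μ := volume)] with x hx
    rw [← eLpNorm_exponent_top] at hx
    rw [Lp.norm_def, ← toReal_enorm]
    exact ENNReal.toReal_mono (Lp.eLpNorm_ne_top g) hx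
  obtain ⟨f, hf⟩ := exists_of_bound (s := s) (f := fun x => g x * (weight s x)⁻¹) (by fun_prop)
    (C := ‖g‖) (by
      filter_upwards [hgb] with x hx
      have := inv_pos.2 (weight_pos s x)
      rw [abs_mul, abs_of_pos this]
      gcongr
      exact hx)
  refine ⟨f, Lp.ext ?_⟩
  have h1 : (mulWeight s f : ℝ → ℝ) =ᵐ[volume] fun x => f x * weight s x :=
    MemLp.coeFn_toLp f.2
  filter_upwards [h1, hf] with x hx hfx
  rw [hx, hfx, inv_mul_cancel_right₀ (weight_pos s x).ne']

noncomputable instance : PartialOrder (WeightedLInfty s) :=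
  inferInstanceAs (PartialOrder ↥(weightedSubmodule s))

theorem le_iff_ae {f g : WeightedLInfty s} : f ≤ g ↔ ∀ᵐ x : ℝ, f x ≤ g x :=
  AEEqFun.coeFn_le.symm

theorem nonneg_iff_ae {f : WeightedLInfty s} : 0 ≤ f ↔ ∀ᵐ x : ℝ, 0 ≤ f x := by
  rw [le_iff_ae]
  constructor <;> intro h <;> filter_upwards [h, coe_zero (s := s)] with x hx h0
  · rwa [h0] at hx
  · rwa [h0]

instance : IsOrderedAddMonoid (WeightedLInfty s) where
  add_le_add_left f g h k := by
    rw [le_iff_ae] at h ⊢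
    filter_upwards [h, coe_add f k, coe_add g k] with x hx h1 h2
    rw [h1, h2]
    linarith

instance : IsOrderedModule ℝ (WeightedLInfty s) :=
  .of_smul_nonneg fun k hk f hf => by
    rw [nonneg_iff_ae] at hf ⊢
    filter_upwards [hf, coe_smul k f] with x hx h1
    rw [h1]
    positivity

theorem isOrderUnitNorm {e : WeightedLInfty s} (he : ∀ᵐ x : ℝ, e x = (weight s x)⁻¹) :
    IsOrderUnitNorm e := by
  intro u C hC
  rw [norm_le_iff u hC, ← neg_smul, le_iff_ae, le_iff_ae, ← eventually_and]
  refine eventually_congr ?_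
  filter_upwards [he, coe_smul C e, coe_smul (-C) e] with x h1 h2 h3
  rw [h2, h3, h1, abs_le, neg_mul]

theorem ne_zero_of_ae {e : WeightedLInfty s} (he : ∀ᵐ x : ℝ, e x = (weight s x)⁻¹) : e ≠ 0 := by
  rintro rfl
  obtain ⟨x, h1, h2⟩ := (he.and coe_zero).exists
  rw [h2] at h1
  exact (inv_pos.2 (weight_pos s x)).ne h1

variable (hs0 : 0 < s) (hs1 : s < 1)
include hs0 hs1

theorem integrable_mul {k : ℝ → ℝ} (hk : Measurable k) {B : ℝ} (hB : ∀ y, |k y| ≤ B)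
    (u : WeightedLInfty s) : Integrable fun y => k y * u y := by
  have hu := u.measurable_coe
  refine ((integrable_weight_inv hs0 hs1).const_mul (B * ‖u‖)).mono' (by fun_prop) ?_
  filter_upwards [u.abs_le_norm] with y hy
  rw [norm_mul, Real.norm_eq_abs, Real.norm_eq_abs, mul_assoc]
  exact mul_le_mul (hB y) hy (abs_nonneg _) ((abs_nonneg _).trans (hB y))

theorem abs_decay_le (y : ℝ) : |decay s y| ≤ 1 := by
  rw [abs_of_pos (decay_pos s y)]
  exact Real.rpow_le_one_of_one_le_of_nonpos (by linarith [abs_nonneg y]) (by linarith)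

theorem integrable_decay_mul (u : WeightedLInfty s) : Integrable fun y => decay s y * u y :=
  integrable_mul hs0 hs1 (continuous_decay s).measurable (abs_decay_le hs0 hs1) u

theorem exists_decayFunctional : ∃ ℓ : WeightedLInfty s →ₗ[ℝ] ℝ,
    ∀ u, ℓ u = ∫ y, decay s y * u y := by
  refine ⟨⟨⟨fun u => ∫ y, decay s y * u y, fun u v => ?_⟩, fun k u => ?_⟩, fun u => rfl⟩
  · rw [← integral_add (integrable_decay_mul hs0 hs1 u) (integrable_decay_mul hs0 hs1 v)]
    refine integral_congr_ae ?_
    filter_upwards [coe_add u v] with y hy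
    rw [hy]
    ring
  · rw [RingHom.id_apply, smul_eq_mul, ← integral_const_mul]
    refine integral_congr_ae ?_
    filter_upwards [coe_smul k u] with y hy
    simp only [hy]
    ring

theorem integral_decay_mul_pos {u : WeightedLInfty s} (hu : 0 ≤ u) (hu0 : u ≠ 0) :
    0 < ∫ y, decay s y * u y := by
  rw [nonneg_iff_ae] at hu
  have h0 : 0 ≤ᵐ[volume] fun y => decay s y * u y := by
    filter_upwards [hu] with y hy
    exact mul_nonneg (decay_pos s y).le hy
  refine lt_of_le_of_ne (integral_nonneg_of_ae h0) fun h => hu0 ?_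
  have := (integral_eq_zero_iff_of_nonneg_ae h0 (integrable_decay_mul hs0 hs1 u)).1 h.symm
  refine ext_ae ?_
  filter_upwards [this, coe_zero (s := s)] with y hy h1
  rw [h1]
  exact (mul_eq_zero.1 hy).resolve_left (decay_pos s y).ne'

end WeightedLInfty

/-! ### The bounded operator and its rank one comparison. -/

/-- The transfer operator with the kernel `p`. -/
noncomputable def kernelTransfer (p : ℝ → ℝ) (t s : ℝ) (u : ℝ → ℝ) (x : ℝ) : ℝ :=
  t ^ (2 - s) / |x| ^ (2 - s) * ∫ y, p (-y - t ^ 2 / x) * u y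

theorem measurable_kernelTransfer {p : ℝ → ℝ} (hp : Measurable p) (t s : ℝ) {u : ℝ → ℝ}
    (hu : Measurable u) : Measurable (kernelTransfer p t s u) := by
  unfold kernelTransfer
  refine Measurable.mul (by fun_prop) ?_
  have : Measurable fun q : ℝ × ℝ => p (-q.2 - t ^ 2 / q.1) * u q.2 := by fun_prop
  exact this.stronglyMeasurable.integral_prod_right'.measurable

theorem enorm_kernelTransfer_le {p : ℝ → ℝ} (hp : ∀ x, 0 ≤ p x) {t : ℝ} (ht : 0 < t) (s : ℝ)
    (u : ℝ → ℝ) (x : ℝ) :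
    ‖kernelTransfer p t s u x‖ₑ ≤ lintegralTransfer p t s (fun y => ‖u y‖ₑ) x := by
  unfold kernelTransfer lintegralTransfer
  rw [enorm_mul, Real.enorm_of_nonneg (by positivity)]
  refine mul_le_mul_right ((enorm_integral_le_lintegral_enorm _).trans (le_of_eq ?_)) _
  refine lintegral_congr fun y => ?_
  rw [enorm_mul, Real.enorm_of_nonneg (hp _)]

theorem lintegralTransfer_congr {p : ℝ → ℝ} {t s : ℝ} {u v : ℝ → ℝ≥0∞} (huv : u =ᵐ[volume] v) :
    lintegralTransfer p t s u = lintegralTransfer p t s v :=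
  funext fun x => le_antisymm (lintegralTransfer_mono huv.le x)
    (lintegralTransfer_mono huv.symm.le x)

namespace IsCauchyComparable

variable {p : ℝ → ℝ} {c C : ℝ} (hp : IsCauchyComparable p c C)
  {s : ℝ} (hs0 : 0 < s) (hs1 : s < 1) {t : ℝ} (ht : 0 < t)
include hp hs0 hs1

theorem abs_le (x : ℝ) : |p x| ≤ C := by
  rw [abs_of_pos (hp.pos x)]
  exact (hp.upper x).trans (mul_le_of_le_one_right hp.upper_pos.le
    (inv_le_one_of_one_le₀ (by nlinarith [sq_nonneg x])))

theorem integrable_kernel_mul (u : WeightedLInfty s) (X : ℝ) :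
    Integrable fun y => p (-y - X) * u y := by
  have := hp.measurable
  exact WeightedLInfty.integrable_mul hs0 hs1 (k := fun y => p (-y - X)) (by fun_prop)
    (fun y => hp.abs_le hs0 hs1 _) u

include ht

/-- By positivity of the kernel it suffices to test on the inverse weight. The bound holds at every
point, which the continuity argument uses. -/
theorem exists_kernelTransfer_bound : ∃ A : ℝ, 0 < A ∧ ∀ (u : WeightedLInfty s) (x : ℝ),
    |kernelTransfer p t s u x| ≤ A * ‖u‖ * (weight s x)⁻¹ := by
  obtain ⟨A, hA, h⟩ := hp.exists_transfer_weight_inv_le hs0 hs1 ht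
  have hmw := measurable_weight s
  refine ⟨A, hA, fun u x => ?_⟩
  have hx := inv_pos.2 (weight_pos s x)
  have h1 : lintegralTransfer p t s (fun y => ‖u y‖ₑ) x ≤
      lintegralTransfer p t s (fun y => ENNReal.ofReal ‖u‖ * ENNReal.ofReal (weight s y)⁻¹) x := by
    refine lintegralTransfer_mono ?_ x
    filter_upwards [u.abs_le_norm] with y hy
    rw [← ENNReal.ofReal_mul (norm_nonneg u), ← ofReal_norm]
    exact ENNReal.ofReal_le_ofReal hy
  rw [lintegralTransfer_const_mul hp.measurable (by fun_prop)] at h1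
  have h2 := ((enorm_kernelTransfer_le (fun y => (hp.pos y).le) ht s u x).trans h1).trans
    (mul_le_mul_right (h x) _)
  rw [← ENNReal.ofReal_mul (by positivity), ← ENNReal.ofReal_mul (norm_nonneg u), ← ofReal_norm,
    ENNReal.ofReal_le_ofReal_iff (by positivity)] at h2
  rw [← Real.norm_eq_abs]
  linarith

theorem exists_transferOperator : ∃ F : WeightedLInfty s →L[ℝ] WeightedLInfty s,
    ∀ u : WeightedLInfty s, ∀ᵐ x : ℝ, F u x = kernelTransfer p t s u x := by
  obtain ⟨A, hA, hAu⟩ := hp.exists_kernelTransfer_bound hs0 hs1 ht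
  have hex (u : WeightedLInfty s) := WeightedLInfty.exists_of_bound (s := s)
    (measurable_kernelTransfer hp.measurable t s u.measurable_coe) (ae_of_all _ (hAu u))
  choose F hF using hex
  have hint := hp.integrable_kernel_mul hs0 hs1
  have hadd (u v : WeightedLInfty s) : F (u + v) = F u + F v := by
    refine WeightedLInfty.ext_ae ?_
    filter_upwards [hF (u + v), hF u, hF v, (F u).coe_add (F v)] with x h1 h2 h3 h4
    rw [h4, h1, h2, h3]
    unfold kernelTransfer
    rw [← mul_add, ← integral_add (hint u _) (hint v _)]
    congr 1
    refine integral_congr_ae ?_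
    filter_upwards [u.coe_add v] with y hy
    rw [hy, mul_add]
  have hsmul (k : ℝ) (u : WeightedLInfty s) : F (k • u) = k • F u := by
    refine WeightedLInfty.ext_ae ?_
    filter_upwards [hF (k • u), hF u, (F u).coe_smul k] with x h1 h2 h3
    rw [h3, h1, h2]
    unfold kernelTransfer
    rw [mul_left_comm, ← integral_const_mul k]
    congr 1
    refine integral_congr_ae ?_
    filter_upwards [u.coe_smul k] with y hy
    simp only [hy]
    ring
  let F' : WeightedLInfty s →ₗ[ℝ] WeightedLInfty s := ⟨⟨F, hadd⟩, hsmul⟩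
  refine ⟨F'.mkContinuous A fun u => ?_, hF⟩
  refine ((F u).norm_le_iff (by positivity)).2 ?_
  filter_upwards [hF u] with x hx
  rw [hx]
  exact hAu u x

variable {F : WeightedLInfty s →L[ℝ] WeightedLInfty s}
  (hF : ∀ u : WeightedLInfty s, ∀ᵐ x : ℝ, F u x = kernelTransfer p t s u x)
include hF

theorem transferOperator_nonneg {u : WeightedLInfty s} (hu : 0 ≤ u) : 0 ≤ F u := by
  rw [WeightedLInfty.nonneg_iff_ae] at hu ⊢
  filter_upwards [hF u] with x hx
  rw [hx]
  refine mul_nonneg (by positivity) (integral_nonneg_of_ae ?_)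
  filter_upwards [hu] with y hy
  exact mul_nonneg (hp.pos _).le hy

theorem ofReal_transferOperator {u : WeightedLInfty s} (hu : 0 ≤ u) :
    (fun x => ENNReal.ofReal (F u x)) =ᵐ[volume]
      lintegralTransfer p t s (fun y => ENNReal.ofReal (u y)) := by
  rw [WeightedLInfty.nonneg_iff_ae] at hu
  filter_upwards [hF u] with x hx
  rw [hx]
  unfold kernelTransfer lintegralTransfer
  rw [ENNReal.ofReal_mul (by positivity), ofReal_integral_eq_lintegral_ofReal
    (hp.integrable_kernel_mul hs0 hs1 u _)]
  · congr 1
    refine lintegral_congr fun y => ?_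
    rw [ENNReal.ofReal_mul (hp.pos _).le]
  · filter_upwards [hu] with y hy
    exact mul_nonneg (hp.pos _).le hy

/-- On nonnegative functions the operator agrees almost everywhere with its `[0, ∞]`-valued version,
so the cube bounds carry over. -/
theorem exists_isRankOneComparable {e : WeightedLInfty s}
    (he : ∀ᵐ x : ℝ, e x = (weight s x)⁻¹) :
    ∃ (ℓ : WeightedLInfty s →ₗ[ℝ] ℝ) (a b : ℝ), IsRankOneComparable e (F ^ 3) ℓ a b := by
  obtain ⟨ℓ, hℓ⟩ := WeightedLInfty.exists_decayFunctional hs0 hs1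
  obtain ⟨a, ha, hlow⟩ := hp.exists_le_transfer_cube hs0 hs1 ht
  obtain ⟨b, hb, hup⟩ := hp.exists_transfer_cube_le hs0 hs1 ht
  have hpos (u : WeightedLInfty s) (hu : 0 ≤ u) : 0 ≤ F u :=
    hp.transferOperator_nonneg hs0 hs1 ht hF hu
  have hℓu (u : WeightedLInfty s) (hu : 0 ≤ u) :
      ∫⁻ y, ENNReal.ofReal (decay s y) * ENNReal.ofReal (u y) = ENNReal.ofReal (ℓ u) := by
    rw [hℓ, ofReal_integral_eq_lintegral_ofReal
      (WeightedLInfty.integrable_decay_mul hs0 hs1 u)]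
    · refine lintegral_congr fun y => ?_
      rw [ENNReal.ofReal_mul (decay_pos s y).le]
    · filter_upwards [WeightedLInfty.nonneg_iff_ae.1 hu] with y hy
      exact mul_nonneg (decay_pos s y).le hy
  have hℓ0 (u : WeightedLInfty s) (hu : 0 ≤ u) : 0 ≤ ℓ u := by
    rw [hℓ]
    refine integral_nonneg_of_ae ?_
    filter_upwards [WeightedLInfty.nonneg_iff_ae.1 hu] with y hy
    exact mul_nonneg (decay_pos s y).le hy
  have hF3 (u : WeightedLInfty s) : (F ^ 3) u = F (F (F u)) := by
    simp [pow_succ, mul_apply_eq_comp]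
  have hcube (u : WeightedLInfty s) (hu : 0 ≤ u) : (fun x => ENNReal.ofReal ((F ^ 3) u x))
      =ᵐ[volume] lintegralTransfer p t s (lintegralTransfer p t s
        (lintegralTransfer p t s (fun y => ENNReal.ofReal (u y)))) := by
    rw [hF3]
    refine (hp.ofReal_transferOperator hs0 hs1 ht hF (hpos _ (hpos _ hu))).trans (.of_eq ?_)
    rw [lintegralTransfer_congr (hp.ofReal_transferOperator hs0 hs1 ht hF (hpos _ hu)),
      lintegralTransfer_congr (hp.ofReal_transferOperator hs0 hs1 ht hF hu)]
  have hne : ∀ᵐ x : ℝ, x ≠ 0 := by simp [ae_iff]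
  refine ⟨ℓ, a, b, ha, hb, fun u hu hu0 => ?_, fun u hu => ?_, fun u hu => ?_⟩
  · rw [hℓ]
    exact WeightedLInfty.integral_decay_mul_pos hs0 hs1 hu hu0
  all_goals
    have hum : Measurable fun y => ENNReal.ofReal (u y) := u.measurable_coe.ennreal_ofReal
    have hu3 : 0 ≤ (F ^ 3) u := by rw [hF3]; exact hpos _ (hpos _ (hpos _ hu))
    have h0 := hℓ0 u hu
    rw [WeightedLInfty.le_iff_ae]
    filter_upwards [hcube u hu, WeightedLInfty.nonneg_iff_ae.1 hu3, hne, he,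
      e.coe_smul (a * ℓ u), e.coe_smul (b * ℓ u)] with x h1 h2 h3 h4 h5 h6
    have hx := inv_pos.2 (weight_pos s x)
  · have := hlow _ hum x h3
    rw [hℓu u hu, ← h1, ← ENNReal.ofReal_mul ha.le, ← ENNReal.ofReal_mul (by positivity),
      ENNReal.ofReal_le_ofReal_iff h2] at this
    rwa [h5, h4]
  · have := hup _ hum x
    rw [hℓu u hu, ← h1, ← ENNReal.ofReal_mul hb.le, ← ENNReal.ofReal_mul (by positivity),
      ENNReal.ofReal_le_ofReal_iff (by positivity)] at this
    rwa [h6, h4]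

end IsCauchyComparable

/-! ### Continuity of eigenfunctions, in particular at zero. -/

namespace IsCauchyComparable

variable {p : ℝ → ℝ} {c C : ℝ} (hp : IsCauchyComparable p c C)
include hp

theorem integrable : Integrable p := by
  refine (integrable_inv_one_add_sq.const_mul C).mono' hp.measurable.aestronglyMeasurable
    (ae_of_all _ fun x => ?_)
  rw [Real.norm_of_nonneg (hp.pos x).le]
  exact hp.upper x

variable {s : ℝ} (hs0 : 0 < s) (hs1 : s < 1) {t : ℝ} (ht : 0 < t)
include hs0 hs1

theorem continuous_conv (u : WeightedLInfty s) : Continuous fun X => ∫ y, p (-y - X) * u y := by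
  have hI := (integrable_weight_inv hs0 hs1).const_mul (C * ‖u‖)
  refine continuous_of_dominated (fun X => (hp.integrable_kernel_mul hs0 hs1 u X).1) (fun X => ?_)
    hI (ae_of_all _ fun y => (hp.continuous.comp (by fun_prop)).mul continuous_const)
  filter_upwards [u.abs_le_norm] with y hy
  rw [norm_mul, Real.norm_eq_abs, Real.norm_eq_abs, mul_assoc]
  exact mul_le_mul (hp.abs_le hs0 hs1 _) hy (abs_nonneg _) hp.upper_pos.le

include ht

/-- The part of a rescaled convolution where the argument of `p` is large is negligible. -/
theorem tendsto_integral_far {φ : ℝ → ℝ} (hφ : Integrable φ) :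
    Tendsto (fun x : ℝ => ∫ y, Set.indicator {y | |t ^ 2 / x| / 2 < |y + t ^ 2 / x|}
      (fun y => (|x| ^ (2 - s))⁻¹ * (p (-y - t ^ 2 / x) * φ y)) y) (𝓝[≠] 0) (𝓝 0) := by
  have hC := hp.upper_pos
  have hlim : Tendsto (fun x : ℝ => 4 * C / t ^ 4 * |x| ^ s * ∫ y, |φ y|) (𝓝[≠] 0) (𝓝 0) := by
    have : Continuous fun x : ℝ => 4 * C / t ^ 4 * |x| ^ s * ∫ y, |φ y| := by
      have : Continuous fun x : ℝ => |x| ^ s := continuous_abs.rpow_const fun _ => Or.inr hs0.le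
      fun_prop
    have h := (this.tendsto 0).mono_left (nhdsWithin_le_nhds (s := {0}ᶜ))
    simpa [Real.zero_rpow hs0.ne'] using h
  refine squeeze_zero_norm' ?_ hlim
  filter_upwards [self_mem_nhdsWithin] with x hx
  have hx0 : 0 < |x| := abs_pos.2 hx
  rw [← integral_const_mul]
  refine norm_integral_le_of_norm_le (hφ.abs.const_mul _) (ae_of_all _ fun y => ?_)
  rw [norm_indicator_eq_indicator_norm]
  refine Set.indicator_apply_le' (fun hy => ?_) fun _ => by positivity
  simp only [Set.mem_ofPred_eq] at hy
  rw [norm_mul, norm_mul, Real.norm_of_nonneg (by positivity), Real.norm_of_nonneg (hp.pos _).le,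
    Real.norm_eq_abs, ← mul_assoc]
  refine mul_le_mul_of_nonneg_right ?_ (abs_nonneg _)
  -- The tail of `p` gives `|x| ^ 2` against the factor `|x| ^ (s - 2)`, leaving `|x| ^ s`, which
  -- tends to zero.
  have h1 : p (-y - t ^ 2 / x) ≤ 4 * C / t ^ 4 * |x| ^ (2 : ℝ) := by
    calc p (-y - t ^ 2 / x) ≤ C * (1 + (y + t ^ 2 / x) ^ 2)⁻¹ := hp.upper_neg_sub _ _
      _ ≤ C * (4 * (1 + (t ^ 2 / x) ^ 2)⁻¹) :=
          mul_le_mul_of_nonneg_left (inv_one_add_sq_le_of_half_le hy.le) hC.le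
      _ ≤ C * (4 * ((t ^ 2 / x) ^ 2)⁻¹) := by
          have : 0 < (t ^ 2 / x) ^ 2 := by have : x ≠ 0 := hx; positivity
          gcongr
          linarith
      _ = _ := by
          rw [Real.rpow_two, sq_abs, div_pow]
          field_simp
  calc (|x| ^ (2 - s))⁻¹ * p (-y - t ^ 2 / x)
      ≤ (|x| ^ (2 - s))⁻¹ * (4 * C / t ^ 4 * |x| ^ (2 : ℝ)) := by gcongr
    _ = _ := by
        rw [Real.rpow_sub hx0]
        have : 0 < |x| ^ s := by positivity
        have : 0 < |x| ^ (2 : ℝ) := by positivity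
        field_simp

/-- The limit of the main part of a rescaled convolution, for a function `φ` with a power law
asymptotics at infinity. -/
theorem tendsto_integral_near {φ g : ℝ → ℝ} {B : ℝ} (hB : 0 ≤ B) (hφm : Measurable φ)
    (hφ : ∀ x, |φ x| ≤ B * (weight s x)⁻¹) (hg : Continuous g)
    (hφg : ∀ z, z ≠ 0 → φ z = (|z| ^ (2 - s))⁻¹ * g (t ^ 2 / z)) :
    Tendsto (fun x : ℝ => ∫ y, Set.indicator {y | |y| ≤ |t ^ 2 / x| / 2}
      (fun y => (|x| ^ (2 - s))⁻¹ * (p y * φ (-y - t ^ 2 / x))) y) (𝓝[≠] 0)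
      (𝓝 (∫ y, p y * (((t ^ 2) ^ (2 - s))⁻¹ * g 0))) := by
  have hr : 0 < 2 - s := by linarith
  have hpm := hp.measurable
  refine tendsto_integral_filter_of_dominated_convergence
    (fun y => B * ((t ^ 2 / 2) ^ (2 - s))⁻¹ * p y) ?_ ?_ (hp.integrable.const_mul _) ?_
  · refine Eventually.of_forall fun x => ?_
    refine Measurable.aestronglyMeasurable (Measurable.indicator (by fun_prop) ?_)
    exact measurableSet_le (by fun_prop) (by fun_prop)
  · filter_upwards [self_mem_nhdsWithin] with x hx
    have hx0 : 0 < |x| := abs_pos.2 hx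
    refine ae_of_all _ fun y => ?_
    have hpy := hp.pos y
    rw [norm_indicator_eq_indicator_norm]
    refine Set.indicator_apply_le' (fun hy => ?_) fun _ => by positivity
    simp only [Set.mem_ofPred_eq] at hy
    rw [norm_mul, norm_mul, Real.norm_of_nonneg (by positivity), Real.norm_of_nonneg hpy.le,
      Real.norm_eq_abs]
    set z := -y - t ^ 2 / x with hz
    have hX : |t ^ 2 / x| = t ^ 2 / |x| := by rw [abs_div, abs_of_pos (by positivity)]
    -- The argument of `φ` stays of order `1 / |x|`, so the decay of `φ` absorbs the factor `|x| ^
    -- (s - 2)` and a multiple of `p` dominates.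
    have hzX : t ^ 2 / 2 / |x| ≤ |z| := by
      have h1 : |z| = |t ^ 2 / x + y| := by rw [← abs_neg]; congr 1; rw [hz]; ring
      have h2 := abs_sub_abs_le_abs_add (t ^ 2 / x) y
      rw [hX] at hy h2
      rw [h1, div_right_comm]
      linarith
    have h3 : (t ^ 2 / 2) ^ (2 - s) / |x| ^ (2 - s) ≤ weight s z := by
      rw [← Real.div_rpow (by positivity) hx0.le]
      have := Real.rpow_le_rpow (by positivity) hzX hr.le
      unfold weight
      linarith
    have h4 : |φ z| ≤ B * ((t ^ 2 / 2) ^ (2 - s) / |x| ^ (2 - s))⁻¹ :=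
      (hφ z).trans (mul_le_mul_of_nonneg_left (inv_anti₀ (by positivity) h3) hB)
    calc (|x| ^ (2 - s))⁻¹ * (p y * |φ z|)
        ≤ (|x| ^ (2 - s))⁻¹ * (p y * (B * ((t ^ 2 / 2) ^ (2 - s) / |x| ^ (2 - s))⁻¹)) := by gcongr
      _ = _ := by
          have : 0 < |x| ^ (2 - s) := by positivity
          field_simp
  · refine ae_of_all _ fun y => ?_
    -- With the power law for `φ` inserted, the powers of `|x|` cancel and the integrand extends
    -- continuously to `x = 0`.
    have hcont : ContinuousAt (fun x : ℝ => p y * ((|t ^ 2 + x * y| ^ (2 - s))⁻¹ *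
        g (-(t ^ 2 * x) / (t ^ 2 + x * y)))) 0 := by
      have h0 : t ^ 2 + 0 * y ≠ 0 := by rw [zero_mul, add_zero]; positivity
      have h1 : ContinuousAt (fun x : ℝ => |t ^ 2 + x * y| ^ (2 - s)) 0 :=
        (show ContinuousAt (fun x : ℝ => |t ^ 2 + x * y|) 0 by fun_prop).rpow_const (Or.inr hr.le)
      have h2 : ContinuousAt (fun x : ℝ => -(t ^ 2 * x) / (t ^ 2 + x * y)) 0 :=
        ContinuousAt.div (by fun_prop) (by fun_prop) h0
      have h3 : |t ^ 2 + 0 * y| ^ (2 - s) ≠ 0 := (Real.rpow_pos_of_pos (abs_pos.2 h0) _).ne'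
      exact continuousAt_const.mul ((h1.inv₀ h3).mul (hg.continuousAt.comp h2))
    have hlim := hcont.tendsto.mono_left (nhdsWithin_le_nhds (s := {0}ᶜ))
    simp only [zero_mul, add_zero, mul_zero, neg_zero, zero_div] at hlim
    rw [abs_of_pos (show 0 < t ^ 2 by positivity)] at hlim
    refine hlim.congr' ?_
    have hev : ∀ᶠ x : ℝ in 𝓝 0, |x| * |y| < t ^ 2 / 2 := by
      have : Continuous fun x : ℝ => |x| * |y| := by fun_prop
      refine this.continuousAt.eventually_lt continuousAt_const ?_
      simp only [abs_zero, zero_mul]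
      positivity
    filter_upwards [self_mem_nhdsWithin, nhdsWithin_le_nhds hev] with x hx hxy
    have hx' : x ≠ 0 := hx
    have hx0 : 0 < |x| := abs_pos.2 hx
    have hX : |t ^ 2 / x| = t ^ 2 / |x| := by rw [abs_div, abs_of_pos (by positivity)]
    have hmem : y ∈ {y : ℝ | |y| ≤ |t ^ 2 / x| / 2} := by
      simp only [Set.mem_ofPred_eq]
      rw [hX, div_right_comm, le_div_iff₀ hx0]
      linarith
    have ht2 : 0 < t ^ 2 := by positivity
    have hden : 0 < t ^ 2 + x * y := by
      have := neg_abs_le (x * y)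
      rw [abs_mul] at this
      linarith
    have hz : -y - t ^ 2 / x = -(t ^ 2 + x * y) / x := by field_simp; ring
    have hz0 : -y - t ^ 2 / x ≠ 0 := by
      rw [hz]
      exact div_ne_zero (neg_ne_zero.2 hden.ne') hx'
    rw [Set.indicator_of_mem hmem, hφg _ hz0, hz, abs_div, abs_neg,
      Real.div_rpow (abs_nonneg _) (abs_nonneg _)]
    have h1 : t ^ 2 / (-(t ^ 2 + x * y) / x) = -(t ^ 2 * x) / (t ^ 2 + x * y) := by
      field_simp
    rw [h1]
    have h2 : 0 < |x| ^ (2 - s) := by positivity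
    have h3 : 0 < |t ^ 2 + x * y| ^ (2 - s) := Real.rpow_pos_of_pos (abs_pos.2 hden.ne') _
    field_simp

/-- Eigenvectors with a nonzero eigenvalue have a continuous representative. -/
theorem exists_continuous_eigenvector {u : WeightedLInfty s} {lam : ℝ} (hlam : lam ≠ 0)
    (hu : ∀ᵐ x : ℝ, kernelTransfer p t s u x = lam * u x) :
    ∃ v : ℝ → ℝ, Continuous v ∧ ∀ᵐ x : ℝ, u x = v x := by
  have hr : 0 < 2 - s := by linarith
  obtain ⟨A, hA, hAu⟩ := hp.exists_kernelTransfer_bound hs0 hs1 ht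
  set G : ℝ → ℝ := fun X => ∫ y, p (-y - X) * u y with hG
  have hGc : Continuous G := hp.continuous_conv hs0 hs1 u
  -- The eigenvalue equation supplies a representative defined at every point, continuous away from
  -- zero.
  set φ : ℝ → ℝ := fun x => lam⁻¹ * kernelTransfer p t s u x with hφ
  have huφ : ∀ᵐ x : ℝ, u x = φ x := by
    filter_upwards [hu] with x hx
    rw [hφ]
    simp only [hx]
    rw [inv_mul_cancel_left₀ hlam]
  have hφm : Measurable φ :=
    (measurable_kernelTransfer hp.measurable t s u.measurable_coe).const_mul _
  have hφg (z : ℝ) : φ z = (|z| ^ (2 - s))⁻¹ * (lam⁻¹ * t ^ (2 - s) * G (t ^ 2 / z)) := by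
    simp only [hφ, kernelTransfer, hG]
    ring
  have hφb (x : ℝ) : |φ x| ≤ |lam|⁻¹ * (A * ‖u‖) * (weight s x)⁻¹ := by
    simp only [hφ]
    rw [abs_mul, abs_inv, mul_assoc]
    exact mul_le_mul_of_nonneg_left (hAu u x) (by positivity)
  have hφi : Integrable φ := by
    refine ((integrable_weight_inv hs0 hs1).const_mul (|lam|⁻¹ * (A * ‖u‖))).mono'
      hφm.aestronglyMeasurable (ae_of_all _ hφb)
  have hnear := hp.tendsto_integral_near hs0 hs1 ht (by positivity) hφm hφb
    (g := fun X => lam⁻¹ * t ^ (2 - s) * G X) (by fun_prop) (fun z _ => hφg z)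
  have hfar := hp.tendsto_integral_far hs0 hs1 ht hφi
  -- Split according to whether the argument of `p` exceeds `|t ^ 2 / x| / 2`, and in the near part
  -- take that argument as the new variable.
  have hsum (x : ℝ) : (∫ y, Set.indicator {y | |y| ≤ |t ^ 2 / x| / 2}
      (fun y => (|x| ^ (2 - s))⁻¹ * (p y * φ (-y - t ^ 2 / x))) y) +
      (∫ y, Set.indicator {y | |t ^ 2 / x| / 2 < |y + t ^ 2 / x|}
      (fun y => (|x| ^ (2 - s))⁻¹ * (p (-y - t ^ 2 / x) * φ y)) y)
      = (|x| ^ (2 - s))⁻¹ * G (t ^ 2 / x) := by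
    set X := t ^ 2 / x
    set f : ℝ → ℝ := fun y => (|x| ^ (2 - s))⁻¹ * (p (-y - X) * φ y) with hf
    have hS : MeasurableSet {y : ℝ | |X| / 2 < |y + X|} :=
      measurableSet_lt (by fun_prop) (by fun_prop)
    have hGφ : G X = ∫ y, p (-y - X) * φ y := by
      refine integral_congr_ae ?_
      filter_upwards [huφ] with y hy
      rw [hy]
    have hfi : Integrable f := by
      refine Integrable.const_mul ?_ _
      refine (hp.integrable_kernel_mul hs0 hs1 u X).congr ?_
      filter_upwards [huφ] with y hy
      rw [hy]
    have h1 : (∫ y, Set.indicator {y | |y| ≤ |X| / 2}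
        (fun y => (|x| ^ (2 - s))⁻¹ * (p y * φ (-y - X))) y)
        = ∫ y, Set.indicator {y : ℝ | |X| / 2 < |y + X|}ᶜ f y := by
      rw [← integral_sub_left_eq_self _ volume (-X)]
      refine integral_congr_ae (ae_of_all _ fun y => ?_)
      have hmem : (-X - y ∈ {y : ℝ | |y| ≤ |X| / 2}) ↔ y ∈ {y : ℝ | |X| / 2 < |y + X|}ᶜ := by
        simp only [Set.mem_ofPred_eq, Set.mem_compl_iff, not_lt]
        rw [show -X - y = -(y + X) by ring, abs_neg]
      by_cases hy : y ∈ {y : ℝ | |X| / 2 < |y + X|}ᶜ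
      · simp only
        rw [Set.indicator_of_mem hy, Set.indicator_of_mem (hmem.2 hy), hf]
        simp only
        rw [show -(-X - y) - X = y by ring, show -X - y = -y - X by ring]
      · simp only
        rw [Set.indicator_of_notMem hy, Set.indicator_of_notMem (fun h => hy (hmem.1 h))]
    rw [h1, integral_indicator hS.compl, integral_indicator hS, add_comm,
      integral_add_compl hS hfi, hGφ, hf, integral_const_mul]
  have hlim := (hnear.add hfar).congr hsum
  rw [add_zero] at hlim
  set l := ∫ y, p y * (((t ^ 2) ^ (2 - s))⁻¹ * (lam⁻¹ * t ^ (2 - s) * G 0))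
  have hφlim : Tendsto φ (𝓝[≠] 0) (𝓝 (lam⁻¹ * t ^ (2 - s) * l)) := by
    refine (hlim.const_mul (lam⁻¹ * t ^ (2 - s))).congr fun x => ?_
    rw [hφg]
    ring
  have hne : ∀ᵐ x : ℝ, x ≠ 0 := by simp [ae_iff]
  refine ⟨Function.update φ 0 (lam⁻¹ * t ^ (2 - s) * l), continuous_iff_continuousAt.2 fun x => ?_, ?_⟩
  · rcases eq_or_ne x 0 with rfl | hx
    · exact continuousAt_update_same.2 hφlim
    · rw [continuousAt_update_of_ne hx]
      have h1 : ContinuousAt (fun z : ℝ => (|z| ^ (2 - s))⁻¹) x :=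
        (continuous_abs.continuousAt.rpow_const (Or.inr hr.le)).inv₀
          (Real.rpow_pos_of_pos (abs_pos.2 hx) _).ne'
      have h2 : ContinuousAt (fun z : ℝ => G (t ^ 2 / z)) x :=
        hGc.continuousAt.comp (continuousAt_const.div continuousAt_id hx)
      have h3 := h1.mul (h2.const_mul (lam⁻¹ * t ^ (2 - s)))
      exact h3.congr (Eventually.of_forall fun z => (hφg z).symm)
  · filter_upwards [huφ, hne] with x hx hx0
    rw [hx, Function.update_of_ne hx0]

end IsCauchyComparable

/-! ### Conclusion for the density of the self-energy. -/

/-- The Radon–Nikodym derivative is determined only almost everywhere. As `y ↦ -y - X` preserves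
null sets, the continuous version may replace it in the integral at every `X`. -/
theorem IsRegularDensity.selfEnergyDensity_mul_ae {L : ℝ} {ρ : ℝ → ℝ} (hρ : IsRegularDensity L ρ) (hL : 0 < L)
    (K : ℕ) (t E : ℝ) (μ : Measure ℝ) [IsProbabilityMeasure μ] (u : ℝ → ℝ) (X : ℝ) :
    (fun y => selfEnergyDensity ρ K t E μ (-y - X) * u y) =ᵐ[volume]
      fun y => iterDensity ρ t E (K - 1) μ (-y - X) * u y := by
  have hq : Measure.QuasiMeasurePreserving (fun y : ℝ => -X - y) volume volume :=
    (Measure.measurePreserving_sub_left volume (-X)).quasiMeasurePreserving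
  have h := hq.ae (hρ.selfEnergyDensity_ae hL t E μ K)
  filter_upwards [h] with y hy
  rw [show -y - X = -X - y by ring, hy]

theorem lemma2p4 (ρ : ℝ → ℝ) (L : ℝ) (hL : 0 < L) (hρ : IsRegularDensity L ρ)
    (s t E : ℝ) (hs0 : 0 < s) (hs1 : s < 1) (ht : 0 < t) (K : ℕ) (hK : 1 < K)
    (μ : Measure ℝ) [IsProbabilityMeasure μ] (hμ : SolvesRDE ρ K t E μ) :
    -- the integral that defines `F u` converges
    (∀ u : WeightedLInfty s, ∀ x : ℝ, x ≠ 0 →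
      Integrable (fun y => selfEnergyDensity ρ K t E μ (-y - t ^ 2 / x) * u y) volume) ∧
    -- `F` is a bounded linear operator on `𝒳`
    ∃ F : WeightedLInfty s →L[ℝ] WeightedLInfty s,
      (∀ u : WeightedLInfty s, ∀ᵐ x : ℝ, F u x = transfer ρ K t s E μ u x) ∧
      ∃ (lam : ℝ) (v : WeightedLInfty s),
        -- `v` is an eigenvector with a positive eigenvalue, and is strictly positive
        0 < lam ∧ F v = lam • v ∧
        (∃ v₀ : ℝ → ℝ, Continuous v₀ ∧ (∀ x, 0 < v₀ x) ∧ ∀ᵐ x : ℝ, v x = v₀ x) ∧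
        -- the eigenvalue is the spectral radius, for the real spectrum and
        -- in the sense of Gelfand's formula
        spectralRadius ℝ F = ENNReal.ofReal lam ∧
        Tendsto (fun n : ℕ => ‖F ^ n‖ ^ (1 / (n : ℝ))) atTop (𝓝 lam) ∧
        -- every nonnegative eigenvector is a positive multiple of `v`
        ∀ (u : WeightedLInfty s) (κ : ℝ), u ≠ 0 → (∀ᵐ x : ℝ, 0 ≤ u x) → F u = κ • u →
          κ = lam ∧ ∃ c : ℝ, 0 < c ∧ u = c • v := by
  -- Here `K > 1` enters: at least one Γ contributes to the kernel density, as the lower Cauchy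
  -- bound requires.
  obtain ⟨M, hM⟩ : ∃ M, K - 1 = M + 1 := ⟨K - 2, by omega⟩
  obtain ⟨C, hC, hup⟩ := hρ.exists_iterDensity_le hL ht hμ (K - 1)
  obtain ⟨c, hc, hlow⟩ := hρ.exists_le_iterDensity_succ hL ht hμ M
  rw [← hM] at hlow
  have hp : IsCauchyComparable (iterDensity ρ t E (K - 1) μ) c C :=
    ⟨hρ.continuous_iterDensity hL t E μ _, hc, hlow, hup⟩
  have htr (u : WeightedLInfty s) (x : ℝ) :
      transfer ρ K t s E μ u x = kernelTransfer (iterDensity ρ t E (K - 1) μ) t s u x := by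
    unfold transfer kernelTransfer
    rw [integral_congr_ae (hρ.selfEnergyDensity_mul_ae hL K t E μ u (t ^ 2 / x))]
  refine ⟨fun u x _ => (hp.integrable_kernel_mul hs0 hs1 u _).congr
    (hρ.selfEnergyDensity_mul_ae hL K t E μ u (t ^ 2 / x)).symm, ?_⟩
  obtain ⟨F, hF⟩ := hp.exists_transferOperator hs0 hs1 ht
  obtain ⟨e, he⟩ := WeightedLInfty.exists_of_bound (s := s) (measurable_weight s).inv (C := 1)
    (ae_of_all _ fun x => by
      rw [Pi.inv_apply, abs_of_pos (inv_pos.2 (weight_pos s x)), one_mul])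
  obtain ⟨ℓ, a, b, hT⟩ := hp.exists_isRankOneComparable hs0 hs1 ht hF he
  obtain ⟨lam, v, hlam, hFv, ⟨ε, hε, hεv⟩, hrad, hlim, huniq⟩ :=
    (WeightedLInfty.isOrderUnitNorm he).perron_frobenius (WeightedLInfty.ne_zero_of_ae he)
      (fun u hu => hp.transferOperator_nonneg hs0 hs1 ht hF hu) three_ne_zero hT
  refine ⟨F, fun u => ?_, lam, v, hlam, hFv, ?_, hrad, hlim,
    fun u κ hu0 hu hFu => huniq u κ hu0 (WeightedLInfty.nonneg_iff_ae.2 hu) hFu⟩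
  · filter_upwards [hF u] with x hx
    rw [hx, htr]
  · obtain ⟨v₀, hv₀, hvv₀⟩ := hp.exists_continuous_eigenvector hs0 hs1 ht hlam.ne' (u := v) (by
      filter_upwards [hF v, v.coe_smul lam] with x h1 h2
      rw [← h1, hFv, h2])
    refine ⟨v₀, hv₀, fun x => ?_, hvv₀⟩
    have hw : Continuous fun x => ε * (weight s x)⁻¹ := by
      unfold weight
      refine continuous_const.mul (Continuous.inv₀ ?_ fun x => (weight_pos s x).ne')
      exact continuous_const.add (continuous_abs.rpow_const fun _ => Or.inr (by linarith))
    have hae : ∀ᵐ x : ℝ, ε * (weight s x)⁻¹ ≤ v₀ x := by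
      filter_upwards [WeightedLInfty.le_iff_ae.1 hεv, e.coe_smul ε, he, hvv₀] with y h1 h2 h3 h4
      rw [h2, h3, h4] at h1
      exact h1
    -- A closed set of full measure is the whole line, so the bound holds everywhere and gives
    -- strict positivity, including at zero.
    have hle : ∀ x, ε * (weight s x)⁻¹ ≤ v₀ x := by
      have hcl : IsClosed {x | ε * (weight s x)⁻¹ ≤ v₀ x} := isClosed_le hw hv₀
      have hd : Dense {x | ε * (weight s x)⁻¹ ≤ v₀ x} := Measure.dense_of_ae hae
      exact fun x => hcl.closure_subset (hd x)
    exact lt_of_lt_of_le (mul_pos hε (inv_pos.2 (weight_pos s x))) (hle x)
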